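/- Let $\mathcal H$ be a separable quaternionic (right) Hilbert space with scalar product $\langle\cdot,\cdot\rangle$, right linear in the second variable, and let $\mathcal B(\mathcal H)$ be the set of bounded right linear operators on $\mathcal H$. Let $J\in\mathcal B(\mathcal H)$ be anti-selfadjoint and unitary, i.e. $J^*=-J=J^{-1}$, let $i$ be a quaternion with $\operatorname{Re} i=0$ and $|i|=1$, and put $\mathbb C_i=\{a_0+ia_1: a_0,a_1\in\mathbb R\}$. For a compact $T\in\mathcal B(\mathcal H)$ let $\lambda_0(T)\ge\lambda_1(T)\ge\dots\ge0$ be its singular values, i.e. the nonzero eigenvalues of $|T|=\sqrt{T^*T}$ in decreasing order, repeated according to multiplicity, followed by zeros if there are only finitely many. For $0<p<\infty$ let $S_p(J)$ be the set of all compact $T\in\mathcal B(\mathcal H)$ with $TJ=JT$ and $\sum_n\lambda_n(T)^p<\infty$, and let $\|T\|_p=\big(\sum_n\lambda_n(T)^p\big)^{1/p}$. Let $S_\infty(J)$ be the set of all $T\in\mathcal B(\mathcal H)$ with $TJ=JT$, with $\|T\|_\infty=\|T\|$ the operator norm. For $a=a_0+ia_1\in\mathbb C_i$ put $aT=a_0T+a_1JT$.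 For $T\in S_1(J)$ let $$\operatorname{Tr}_{Ji}(T)=\sum_n\langle e_n,Te_n\rangle\in\mathbb C_i,$$ where $(e_n)$ is an orthonormal basis of the complex Hilbert space $\mathcal H_+^{Ji}=\{x\in\mathcal H: Jx=xi\}$; that is, $\operatorname{Tr}_{Ji}(T)$ is the trace of the restriction of $T$ to $\mathcal H_+^{Ji}$. Let $1\le p<\infty$ and $\frac1p+\frac1q=1$ (so $q=\infty$ if $p=1$). Then $S_p(J)$ and $S_q(J)$ are normed spaces over $\mathbb C_i$; for $T\in S_p(J)$ and $S\in S_q(J)$ the product $TS$ belongs to $S_1(J)$, and the series for $\operatorname{Tr}_{Ji}(TS)$ converges to the same value for every orthonormal basis of $\mathcal H_+^{Ji}$; and $$S_p(J)^*=S_q(J)$$ with equal norms under the pairing $\langle T,S\rangle=\operatorname{Tr}_{Ji}(TS)$: the map $S\mapsto\operatorname{Tr}_{Ji}(\,\cdot\,S)$ is a $\mathbb C_i$-linear isometric bijection of $S_q(J)$ onto the space $S_p(J)^*$ of bounded $\mathbb C_i$-linear functionals $S_p(J)\to\mathbb C_i$ with the dual norm. -/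

import Mathlib

open MulOpposite Quaternion
open scoped ENNReal

noncomputable section

namespace QuatSchatten

/-- A quaternionic inner product on a right `ℍ`-vector space `H` (a module over `ℍᵐᵒᵖ`, where
`op a • x` is the product `x a`): it is `ℍ`-valued, right linear in the second variable, hermitian
and positive definite, and the norm of `H` is `‖x‖ = √⟨x, x⟩`. -/
class QuaternionicInner (H : Type*) [NormedAddCommGroup H] [Module ℍ[ℝ]ᵐᵒᵖ H]
    extends Inner ℍ[ℝ] H where
  inner_add_right' : ∀ x y z : H, inner x (y + z) = inner x y + inner x z
  inner_smul_right' : ∀ (x y : H) (a : ℍ[ℝ]), inner x (op a • y) = inner x y * a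
  star_inner' : ∀ x y : H, star (inner y x) = inner x y
  inner_self' : ∀ x : H, inner x x = ((‖x‖ ^ 2 : ℝ) : ℍ[ℝ])

/-- The scalar product of `H`. -/
abbrev ip {H : Type*} [NormedAddCommGroup H] [Module ℍ[ℝ]ᵐᵒᵖ H] [QuaternionicInner H]
    (x y : H) : ℍ[ℝ] := inner ℍ[ℝ] x y

/-- The norm is compatible with the right multiplication by quaternions. -/
theorem norm_op_smul {H : Type*} [NormedAddCommGroup H] [Module ℍ[ℝ]ᵐᵒᵖ H]
    [QuaternionicInner H] (a : ℍ[ℝ]) (x : H) : ‖op a • x‖ = ‖a‖ * ‖x‖ := by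
  have h1 : ip (op a • x) (op a • x) = star a * ip x x * a := by
    have h2 : ip (op a • x) x = star a * ip x x := by
      have h3 := QuaternionicInner.star_inner' (op a • x) x
      rw [ip, ip, ← h3, QuaternionicInner.inner_smul_right', star_mul,
        QuaternionicInner.star_inner' x x]
    rw [ip, QuaternionicInner.inner_smul_right']
    exact congrArg (· * a) h2
  have h4 : ((‖op a • x‖ ^ 2 : ℝ) : ℍ[ℝ]) = (((‖a‖ * ‖x‖) ^ 2 : ℝ) : ℍ[ℝ]) := by
    have h5 : ip (op a • x) (op a • x) = ((‖op a • x‖ ^ 2 : ℝ) : ℍ[ℝ]) :=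
      QuaternionicInner.inner_self' _
    have h6 : ip x x = ((‖x‖ ^ 2 : ℝ) : ℍ[ℝ]) := QuaternionicInner.inner_self' _
    rw [← h5, h1, h6, mul_assoc, Quaternion.coe_commutes, ← mul_assoc, Quaternion.star_mul_self,
      Quaternion.normSq_eq_norm_mul_self, ← Quaternion.coe_mul]
    congr 1
    ring
  have h7 : ‖op a • x‖ ^ 2 = (‖a‖ * ‖x‖) ^ 2 := Quaternion.coe_injective h4
  exact (sq_eq_sq₀ (norm_nonneg _) (by positivity)).1 h7

theorem continuous_op_smul {H : Type*} [NormedAddCommGroup H] [Module ℍ[ℝ]ᵐᵒᵖ H]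
    [QuaternionicInner H] (a : ℍ[ℝ]) : Continuous fun x : H => op a • x := by
  refine (LipschitzWith.of_dist_le_mul (K := ‖a‖₊) fun x y => ?_).continuous
  rw [dist_eq_norm, dist_eq_norm, ← smul_sub, norm_op_smul]
  rfl

/-- The bounded right linear operators `ℬ(H)`, with composition as product. -/
abbrev Op (H : Type*) [NormedAddCommGroup H] [Module ℍ[ℝ]ᵐᵒᵖ H] : Type _ := H →L[ℍ[ℝ]ᵐᵒᵖ] H

section Operators

variable {H : Type*} [NormedAddCommGroup H] [Module ℍ[ℝ]ᵐᵒᵖ H] [QuaternionicInner H]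

/-- The operator norm `sup {‖T x‖ : ‖x‖ = 1}`. -/
def opNorm (T : Op H) : ℝ := sSup {r | ∃ x : H, ‖x‖ = 1 ∧ r = ‖T x‖}

/-- `S` is the adjoint of `T`. -/
def IsAdjoint (S T : Op H) : Prop := ∀ x y : H, ip (S x) y = ip x (T y)

/-- `T* = -T`. -/
def IsAntiSelfAdjoint (T : Op H) : Prop := IsAdjoint (-T) T

/-- `T* = T⁻¹`. -/
def IsUnitary (T : Op H) : Prop := ∃ S : Op H, IsAdjoint S T ∧ S * T = 1 ∧ T * S = 1

/-- The singular value decomposition `T x = ∑ₙ σₙ λₙ ⟨eₙ, x⟩`, with `λ` decreasing and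
nonnegative. The `eₙ` with `λₙ ≠ 0` are orthonormal, and so are the corresponding `σₙ`; so the
nonzero `λₙ` are the nonzero eigenvalues of `|T|`, in decreasing order and repeated according to
multiplicity, and the sequence is continued by `0` when `T` has finite rank. -/
def IsSingularValueSeq (T : Op H) (l : ℕ → ℝ) : Prop :=
  Antitone l ∧ (∀ n, 0 ≤ l n) ∧ ∃ e σ : ℕ → H,
    (∀ m n, l m ≠ 0 → l n ≠ 0 → ip (e m) (e n) = if m = n then 1 else 0) ∧
    (∀ m n, l m ≠ 0 → l n ≠ 0 → ip (σ m) (σ n) = if m = n then 1 else 0) ∧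
    ∀ x, HasSum (fun n => op ((l n : ℍ[ℝ]) * ip (e n) x) • σ n) (T x)

open Classical in
/-- The sequence of singular values of a compact operator. -/
def singularValues (T : Op H) : ℕ → ℝ :=
  if h : ∃ l, IsSingularValueSeq T l then h.choose else 0

/-- The `(J,p)`-Schatten class. For `p < ∞` it consists of the compact operators that commute with
`J` and whose singular values are `p`-summable; for `p = ∞` it is the algebra of all bounded
operators that commute with `J`. -/
def schattenClass (J : Op H) (p : ℝ≥0∞) : Set (Op H) :=
  {T | T * J = J * T ∧
    (p ≠ ∞ → IsCompactOperator T ∧ Summable fun n => singularValues T n ^ p.toReal)}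

/-- The Schatten norm `‖T‖_p`: the `ℓ^p`-norm of the singular values for `p < ∞`, the operator norm
for `p = ∞`. -/
def schattenNorm (p : ℝ≥0∞) (T : Op H) : ℝ :=
  open Classical in
  if p = ∞ then opNorm T else (∑' n, singularValues T n ^ p.toReal) ^ (1 / p.toReal)

/-- The operator `a T = a₀ T + a₁ J T` for the scalar `a = a₀ + i a₁` of `ℂ_i`. -/
def leftSMul (J : Op H) (a₀ a₁ : ℝ) (T : Op H) : Op H where
  toFun x := op (a₀ : ℍ[ℝ]) • T x + op (a₁ : ℍ[ℝ]) • J (T x)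
  map_add' x y := by simp only [map_add, smul_add]; abel
  map_smul' c x := by
    have h : ∀ r : ℝ, op (r : ℍ[ℝ]) * c = c * op (r : ℍ[ℝ]) := fun r => by
      apply unop_injective
      simpa using (Quaternion.coe_commutes r (unop c)).symm
    simp only [map_smul, smul_add, smul_smul, RingHom.id_apply, h]
  cont := ((continuous_op_smul _).comp T.continuous).add
    ((continuous_op_smul _).comp (J.continuous.comp T.continuous))

end Operators

/-- The sphere `𝕊` of imaginary units. -/
def imaginaryUnits : Set ℍ[ℝ] := {x | x.re = 0 ∧ ‖x‖ = 1}

/-- The scalar `a₀ + i a₁`. -/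
def planeScalar (i : ℍ[ℝ]) (a₀ a₁ : ℝ) : ℍ[ℝ] := (a₀ : ℍ[ℝ]) + i * (a₁ : ℍ[ℝ])

/-- The complex plane `ℂ_i`. -/
def complexPlane (i : ℍ[ℝ]) : Set ℍ[ℝ] := {z | ∃ a₀ a₁ : ℝ, z = planeScalar i a₀ a₁}

section Trace

variable {H : Type*} [NormedAddCommGroup H] [Module ℍ[ℝ]ᵐᵒᵖ H] [QuaternionicInner H]

/-- The complex subspace `H₊^{Ji} = {x : J x = x i}`. -/
def plusSpace (J : Op H) (i : ℍ[ℝ]) : Set H := {x | J x = op i • x}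

/-- `B` is an orthonormal basis (a total orthonormal set) of the complex Hilbert space
`H₊^{Ji}`, whose scalar product is the restriction of that of `H`. -/
def IsONB (J : Op H) (i : ℍ[ℝ]) (B : Set H) : Prop :=
  B ⊆ plusSpace J i ∧ (∀ x ∈ B, ‖x‖ = 1) ∧ (∀ x ∈ B, ∀ y ∈ B, x ≠ y → ip x y = 0) ∧
    ∀ x ∈ plusSpace J i, (∀ e ∈ B, ip e x = 0) → x = 0

open Classical in
/-- The trace `Tr_{Ji} T = ∑ₙ ⟨eₙ, T eₙ⟩` of the restriction of `T` to `H₊^{Ji}`, where `(eₙ)` is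
an orthonormal basis of `H₊^{Ji}`. -/
def jTrace (J : Op H) (i : ℍ[ℝ]) (T : Op H) : ℍ[ℝ] :=
  if h : ∃ B, IsONB J i B then ∑' e : h.choose, ip (e : H) (T e) else 0

/-- `S_p(J)` is a `ℂ_i`-linear subspace of the operators that commute with `J`, and `‖·‖_p` is a
norm on it. -/
structure IsNormedSchatten (J : Op H) (i : ℍ[ℝ]) (p : ℝ≥0∞) : Prop where
  zero_mem : (0 : Op H) ∈ schattenClass J p
  add_mem : ∀ T ∈ schattenClass J p, ∀ S ∈ schattenClass J p, T + S ∈ schattenClass J p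
  smul_mem : ∀ a₀ a₁ : ℝ, ∀ T ∈ schattenClass J p, leftSMul J a₀ a₁ T ∈ schattenClass J p
  norm_nonneg : ∀ T ∈ schattenClass J p, 0 ≤ schattenNorm p T
  norm_eq_zero : ∀ T ∈ schattenClass J p, (schattenNorm p T = 0 ↔ T = 0)
  norm_add_le : ∀ T ∈ schattenClass J p, ∀ S ∈ schattenClass J p,
    schattenNorm p (T + S) ≤ schattenNorm p T + schattenNorm p S
  norm_smul : ∀ a₀ a₁ : ℝ, ∀ T ∈ schattenClass J p,
    schattenNorm p (leftSMul J a₀ a₁ T) = ‖planeScalar i a₀ a₁‖ * schattenNorm p T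

/-- The dual `S_p(J)^*`: the bounded `ℂ_i`-linear functionals `S_p(J) → ℂ_i`. -/
@[ext] structure SchattenDual (J : Op H) (i : ℍ[ℝ]) (p : ℝ≥0∞) where
  toFun : schattenClass J p → ℍ[ℝ]
  mem_plane' : ∀ T, toFun T ∈ complexPlane i
  map_add' : ∀ T S R : schattenClass J p, (R : Op H) = (T : Op H) + (S : Op H) →
    toFun R = toFun T + toFun S
  map_smul' : ∀ (a₀ a₁ : ℝ) (T R : schattenClass J p), (R : Op H) = leftSMul J a₀ a₁ (T : Op H) →
    toFun R = planeScalar i a₀ a₁ * toFun T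
  bound' : ∃ C : ℝ, ∀ T : schattenClass J p, ‖toFun T‖ ≤ C * schattenNorm p (T : Op H)

/-- The norm of a functional: its supremum over the unit ball of `S_p(J)`. -/
def dualNorm {J : Op H} {i : ℍ[ℝ]} {p : ℝ≥0∞} (ξ : SchattenDual J i p) : ℝ :=
  sSup {r | ∃ T : schattenClass J p, schattenNorm p (T : Op H) ≤ 1 ∧ r = ‖ξ.toFun T‖}

end Trace

end QuatSchatten

end

open QuatSchatten

/-! The theorem reduces to the duality of Schatten classes on the complex Hilbert space `K =
H₊^{Ji}`. With a unit `j` anticommuting with `i`, `H` is the sum of `K` and `K j`, so an operator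
commuting with `J` is determined by its restriction to `K`, and every bounded complex operator on
`K` arises this way: `compress` and `extend` are mutually inverse. Under this correspondence
`leftSMul` becomes complex scalar multiplication, and operator norm, compactness and the `ℓ^p`-norm
of the singular values are preserved (`opNorm_eq_norm_compress`, `mem_schattenClass_iff`,
`schattenNorm_eq`). Orthonormal bases of `K` compute the trace on both sides.

On `K` the Schatten norm is handled through `varNorm p T`, the supremum of the `ℓ^p`-norms of `⟪g k,
T (f k)⟫` over pairs of Bessel sequences. Minkowski's inequality makes it subadditive, and for `p =
∞` it is the operator norm. For `p < ∞` finiteness forces compactness, and a Schur test shows that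
it equals the `ℓ^p`-norm of the singular values (`IsSVD.varNorm_eq`). Bessel sequences, unlike
orthonormal ones, may be padded by zeros and are stable under the changes of vectors needed for
Hölder's inequality.

Hölder's inequality `varNorm_mul_le` makes `Tr(TS)` a bounded pairing. Conversely, a bounded
functional restricted to rank one operators is a bounded sesquilinear form and yields an operator
`S` by Riesz. Testing on finite sums of rank one operators, together with the converse of Hölder's
inequality for sequences, bounds `varNorm q S` by the norm of the functional. Truncated singular
value decompositions are dense, so the functional is `Tr(· S)` everywhere (`exists_opTrace_eq`). -/

namespace QuatSchatten

open MeasureTheory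

/-! ### Inequalities for sequences: Jensen, a Schur test, Hölder and its converse. -/

/-- Jensen's inequality for substochastic weights. -/
theorem tsum_mul_rpow_le {w l : ℕ → ℝ≥0∞} (hw : ∑' n, w n ≤ 1) {p : ℝ} (hp : 1 ≤ p) :
    (∑' n, w n * l n) ^ p ≤ ∑' n, w n * l n ^ p := by
  rcases hp.eq_or_lt with rfl | hp1
  · simp
  have hp0 : 0 < p := by linarith
  have hpq : p.HolderConjugate p.conjExponent := Real.HolderConjugate.conjExponent hp1
  set q := p.conjExponent
  have hq0 : 0 < q := hpq.symm.pos
  -- Hölder for the splitting `w = w^(1/p) * w^(1/q)`; the factor `w^(1/q)` has norm at most `1`.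
  have h := ENNReal.lintegral_mul_le_Lp_mul_Lq (Measure.count : Measure ℕ) hpq
    (f := fun n => w n ^ (1 / p) * l n) (g := fun n => w n ^ (1 / q))
    (measurable_of_countable _).aemeasurable (measurable_of_countable _).aemeasurable
  simp only [lintegral_count, Pi.mul_apply] at h
  have e1 : ∀ n, w n ^ (1 / p) * l n * w n ^ (1 / q) = w n * l n := fun n => by
    rw [mul_right_comm, ← ENNReal.rpow_add_of_nonneg _ _ (by positivity) (by positivity)]
    have : 1 / p + 1 / q = 1 := by simpa using hpq.inv_add_inv_eq_one
    rw [this, ENNReal.rpow_one]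
  have e2 : ∀ n, (w n ^ (1 / p) * l n) ^ p = w n * l n ^ p := fun n => by
    rw [ENNReal.mul_rpow_of_nonneg _ _ hp0.le, ← ENNReal.rpow_mul, one_div_mul_cancel hp0.ne',
      ENNReal.rpow_one]
  have e3 : ∀ n, (w n ^ (1 / q)) ^ q = w n := fun n => by
    rw [← ENNReal.rpow_mul, one_div_mul_cancel hq0.ne', ENNReal.rpow_one]
  simp only [e1, e2, e3] at h
  have h2 : (∑' n, w n * l n) ≤ (∑' n, w n * l n ^ p) ^ (1 / p) := by
    refine h.trans ((mul_le_mul_right (ENNReal.rpow_le_one hw (by positivity)) _).trans ?_)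
    rw [mul_one]
  calc (∑' n, w n * l n) ^ p ≤ ((∑' n, w n * l n ^ p) ^ (1 / p)) ^ p :=
        ENNReal.rpow_le_rpow h2 hp0.le
    _ = _ := by rw [← ENNReal.rpow_mul, one_div_mul_cancel hp0.ne', ENNReal.rpow_one]

theorem ennreal_mul_le_half_sq_add_sq (a b : ℝ≥0∞) : a * b ≤ 2⁻¹ * (a ^ 2 + b ^ 2) := by
  have h : 2 * (a * b) ≤ a ^ 2 + b ^ 2 := by
    rcases eq_or_ne a ∞ with rfl | ha
    · simp
    rcases eq_or_ne b ∞ with rfl | hb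
    · simp
    lift a to NNReal using ha
    lift b to NNReal using hb
    have := two_mul_le_add_sq a b
    rw [mul_assoc] at this
    exact_mod_cast this
  calc a * b = 2⁻¹ * (2 * (a * b)) := by
        rw [← mul_assoc, ENNReal.inv_mul_cancel (by simp) (by simp), one_mul]
    _ ≤ _ := by gcongr

/-- A matrix of products of two matrices whose rows and columns lie in the unit ball of `ℓ²` is a
contraction of `ℓᵖ`. -/
theorem tsum_rpow_tsum_mul_le {α β : ℕ → ℕ → ℝ≥0∞} {l : ℕ → ℝ≥0∞}
    (hα : ∀ k, ∑' n, α k n ^ 2 ≤ 1) (hα' : ∀ n, ∑' k, α k n ^ 2 ≤ 1)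
    (hβ : ∀ k, ∑' n, β k n ^ 2 ≤ 1) (hβ' : ∀ n, ∑' k, β k n ^ 2 ≤ 1) {p : ℝ} (hp : 1 ≤ p) :
    ∑' k, (∑' n, α k n * β k n * l n) ^ p ≤ ∑' n, l n ^ p := by
  have half : ∀ a b : ℝ≥0∞, a ≤ 1 → b ≤ 1 → 2⁻¹ * (a + b) ≤ 1 := fun a b ha hb =>
    calc 2⁻¹ * (a + b) ≤ 2⁻¹ * (1 + 1) := by gcongr
      _ = 1 := by rw [one_add_one_eq_two]; exact ENNReal.inv_mul_cancel (by simp) (by simp)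
  -- By `αβ ≤ (α² + β²)/2` the matrix is dominated by a doubly substochastic one. Jensen along each
  -- row uses the row sums; after exchanging the summations, the column sums finish.
  calc ∑' k, (∑' n, α k n * β k n * l n) ^ p
      ≤ ∑' k, (∑' n, (2⁻¹ * (α k n ^ 2 + β k n ^ 2)) * l n) ^ p := by
        refine ENNReal.tsum_le_tsum fun k => ENNReal.rpow_le_rpow ?_ (by linarith)
        refine ENNReal.tsum_le_tsum fun n => ?_
        exact mul_le_mul' (ennreal_mul_le_half_sq_add_sq _ _) le_rfl
    _ ≤ ∑' k, ∑' n, (2⁻¹ * (α k n ^ 2 + β k n ^ 2)) * l n ^ p := by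
        refine ENNReal.tsum_le_tsum fun k => tsum_mul_rpow_le ?_ hp
        rw [ENNReal.tsum_mul_left, ENNReal.tsum_add]
        exact half _ _ (hα k) (hβ k)
    _ = ∑' n, (2⁻¹ * ∑' k, (α k n ^ 2 + β k n ^ 2)) * l n ^ p := by
        rw [ENNReal.tsum_comm]
        refine tsum_congr fun n => ?_
        rw [ENNReal.tsum_mul_right, ENNReal.tsum_mul_left]
    _ ≤ ∑' n, 1 * l n ^ p := by
        refine ENNReal.tsum_le_tsum fun n => ?_
        gcongr
        rw [ENNReal.tsum_add]
        exact half _ _ (hα' n) (hβ' n)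
    _ = _ := by simp

/-- The `ℓᵖ`-norm of a sequence. -/
noncomputable abbrev seqNorm {E : Type*} [NormedAddCommGroup E] (p : ℝ≥0∞) (a : ℕ → E) : ℝ≥0∞ :=
  eLpNorm a p Measure.count

theorem seqNorm_eq {E : Type*} [NormedAddCommGroup E] {p : ℝ≥0∞} (h0 : p ≠ 0) (ht : p ≠ ∞)
    (a : ℕ → E) : seqNorm p a = (∑' n, ‖a n‖ₑ ^ p.toReal) ^ (1 / p.toReal) := by
  rw [seqNorm, eLpNorm_eq_lintegral_rpow_enorm_toReal h0 ht, lintegral_count]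

theorem seqNorm_rpow {E : Type*} [NormedAddCommGroup E] {p : ℝ≥0∞} (h0 : p ≠ 0) (ht : p ≠ ∞)
    (a : ℕ → E) : seqNorm p a ^ p.toReal = ∑' n, ‖a n‖ₑ ^ p.toReal := by
  rw [seqNorm_eq h0 ht, ← ENNReal.rpow_mul, one_div_mul_cancel (ENNReal.toReal_pos h0 ht).ne',
    ENNReal.rpow_one]

theorem seqNorm_one {E : Type*} [NormedAddCommGroup E] (a : ℕ → E) :
    seqNorm 1 a = ∑' n, ‖a n‖ₑ := by
  rw [seqNorm_eq one_ne_zero ENNReal.one_ne_top]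
  simp

theorem seqNorm_top_le {E : Type*} [NormedAddCommGroup E] {a : ℕ → E} {C : ℝ≥0∞}
    (h : ∀ n, ‖a n‖ₑ ≤ C) : seqNorm ∞ a ≤ C := by
  rw [seqNorm, eLpNorm_exponent_top]
  exact essSup_le_of_ae_le _ (Filter.Eventually.of_forall h)

theorem enorm_le_seqNorm {E : Type*} [NormedAddCommGroup E] {p : ℝ≥0∞} (hp : p ≠ 0) (a : ℕ → E)
    (n : ℕ) : ‖a n‖ₑ ≤ seqNorm p a := by
  rcases eq_or_ne p ∞ with rfl | ht
  · rw [seqNorm, eLpNorm_exponent_top]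
    simpa using le_iSup (fun n => ‖a n‖ₑ) n
  · have h0 := ENNReal.toReal_pos hp ht
    rw [seqNorm_eq hp ht]
    calc ‖a n‖ₑ = (‖a n‖ₑ ^ p.toReal) ^ (1 / p.toReal) := by
          rw [← ENNReal.rpow_mul, mul_one_div_cancel h0.ne', ENNReal.rpow_one]
      _ ≤ _ := ENNReal.rpow_le_rpow (ENNReal.le_tsum n) (by positivity)

/-- Hölder's inequality for sequences. -/
theorem tsum_enorm_mul_le {p q : ℝ≥0∞} (hpq : p.HolderConjugate q) (a b : ℕ → ℂ) :
    ∑' n, ‖a n * b n‖ₑ ≤ seqNorm p a * seqNorm q b := by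
  rw [← seqNorm_one]
  have := eLpNorm_smul_le_mul_eLpNorm (p := p) (q := q) (r := 1) (f := b) (φ := a)
    (μ := (Measure.count : Measure ℕ))
    (measurable_of_countable _).aestronglyMeasurable
    (measurable_of_countable _).aestronglyMeasurable
  exact this

/-- The converse of Hölder's inequality. -/
theorem seqNorm_le_of_forall_sum_mul_le {p q : ℝ≥0∞} (hpq : p.HolderConjugate q) (hp : p ≠ ∞)
    {a : ℕ → ℂ} {C : ℝ≥0∞}
    (h : ∀ (s : Finset ℕ) (c : ℕ → ℂ), (∀ k, k ∉ s → c k = 0) →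
      ‖∑ k ∈ s, c k * a k‖ₑ ≤ C * seqNorm p c) : seqNorm q a ≤ C := by
  have hp1 : 1 ≤ p := hpq.one_le p q
  have hq1 : 1 ≤ q := hpq.symm.one_le q p
  have hp0 : p ≠ 0 := (zero_lt_one.trans_le hp1).ne'
  have hq0 : q ≠ 0 := (zero_lt_one.trans_le hq1).ne'
  rcases eq_or_ne q ∞ with rfl | hq
  · refine seqNorm_top_le fun n => ?_
    have h1 := h {n} (Pi.single n 1) (fun k hk => by
      simp only [Finset.mem_singleton] at hk; simp [hk])
    have h2 : seqNorm p (Pi.single n (1 : ℂ) : ℕ → ℂ) = 1 := by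
      rw [seqNorm_eq hp0 hp, tsum_eq_single n]
      · simp
      · intro k hk
        simp [hk, ENNReal.toReal_pos hp0 hp]
    simpa [h2] using h1
  have hr : p.toReal.HolderConjugate q.toReal := by
    have h1 : p ≠ 1 := by
      rintro rfl
      have := hpq.inv_add_inv_eq_inv
      simp only [inv_one] at this
      have h3 : q⁻¹ = 0 := by
        have : (1 : ℝ≥0∞) + q⁻¹ = 1 + 0 := by simpa using this
        exact (ENNReal.add_right_inj ENNReal.one_ne_top).1 this
      exact hq (ENNReal.inv_eq_zero.1 h3)
    have := hpq.inv_add_inv_eq_inv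
    refine Real.holderConjugate_iff.2 ⟨?_, ?_⟩
    · have := (ENNReal.toReal_lt_toReal ENNReal.one_ne_top hp).2 (lt_of_le_of_ne hp1 h1.symm)
      simpa using this
    · have h4 := congrArg ENNReal.toReal this
      rw [ENNReal.toReal_add (ENNReal.inv_ne_top.2 hp0) (ENNReal.inv_ne_top.2 hq0)] at h4
      simpa using h4
  set P := p.toReal
  set Q := q.toReal
  have hP : 0 < P := hr.pos
  have hQ : 0 < Q := hr.symm.pos
  have hQ1 : 1 < Q := hr.symm.lt
  have key : ∀ s : Finset ℕ, (∑ k ∈ s, ‖a k‖ₑ ^ Q) ^ (1 / Q) ≤ C := by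
    intro s
    set X := ∑ k ∈ s, ‖a k‖ₑ ^ Q with hX
    rcases eq_or_ne X 0 with hX0 | hX0
    · rw [hX0, ENNReal.zero_rpow_of_pos (by positivity)]; exact zero_le
    have hXt : X ≠ ∞ := (ENNReal.sum_lt_top.2 fun k _ =>
      ENNReal.rpow_lt_top_of_nonneg hQ.le enorm_ne_top).ne
    -- The extremal sequence for Hölder: modulus `|a k|^(Q-1)` and conjugate phase, so that `|c k|^P
    -- = |a k|^Q = c k * a k`. Division by zero gives `c k = 0` where `a k = 0`.
    let c : ℕ → ℂ := fun k => if k ∈ s then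
      ((‖a k‖ ^ (Q - 1) / ‖a k‖ : ℝ) : ℂ) * (starRingEnd ℂ) (a k) else 0
    have hc : ∀ k ∈ s, ‖c k‖ₑ ^ P = ‖a k‖ₑ ^ Q := by
      intro k hk
      have : ‖c k‖ = ‖a k‖ ^ (Q - 1) := by
        simp only [c, hk, if_true, norm_mul, Complex.norm_real, RCLike.norm_conj, norm_div,
          Real.norm_eq_abs, abs_norm]
        rw [abs_of_nonneg (by positivity)]
        rcases eq_or_ne ‖a k‖ 0 with h0 | h0
        · rw [h0, Real.zero_rpow (by linarith)]; simp
        · field_simp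
      rw [← ofReal_norm, this, ← ENNReal.ofReal_rpow_of_nonneg (norm_nonneg _) (by linarith),
        ofReal_norm, ← ENNReal.rpow_mul, hr.symm.sub_one_mul_conj]
    have hc2 : ∀ k ∈ s, c k * a k = ((‖a k‖ ^ Q : ℝ) : ℂ) := by
      intro k hk
      simp only [c, hk, if_true]
      rw [mul_assoc, Complex.conj_mul', ← Complex.ofReal_pow, ← Complex.ofReal_mul]
      congr 1
      rcases eq_or_ne ‖a k‖ 0 with h0 | h0
      · rw [h0, Real.zero_rpow hQ.ne']; simp
      · rw [Real.rpow_sub_one h0]; field_simp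
    have h1 := h s c (fun k hk => by simp [c, hk])
    have h2 : seqNorm p c = X ^ (1 / P) := by
      rw [seqNorm_eq hp0 hp, tsum_eq_sum (s := s), hX]
      · congr 1
        exact Finset.sum_congr rfl hc
      · intro k hk
        simp [c, hk, ENNReal.toReal_pos hp0 hp]
    have h3 : ‖∑ k ∈ s, c k * a k‖ₑ = X := by
      rw [Finset.sum_congr rfl hc2, ← Complex.ofReal_sum, ← ofReal_norm, Complex.norm_real,
        Real.norm_of_nonneg (by positivity), ENNReal.ofReal_sum_of_nonneg (fun _ _ => by positivity),
        hX]
      refine Finset.sum_congr rfl fun k _ => ?_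
      rw [← ENNReal.ofReal_rpow_of_nonneg (norm_nonneg _) hQ.le, ofReal_norm]
    rw [h2, h3] at h1
    -- The test inequality reads `X ≤ C * X^(1/P)`; cancelling `X^(1/P)` needs `X` to be neither `0`
    -- nor `∞`, which is why only finite partial sums are tested.
    have h4 : X = X ^ (1 / Q) * X ^ (1 / P) := by
      rw [← ENNReal.rpow_add _ _ hX0 hXt]
      have : 1 / Q + 1 / P = 1 := by simpa using hr.symm.inv_add_inv_eq_one
      rw [this, ENNReal.rpow_one]
    have h5 : X ^ (1 / Q) * X ^ (1 / P) ≤ C * X ^ (1 / P) := h4 ▸ h1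
    exact (ENNReal.mul_le_mul_iff_left (by simp [hX0, hXt])
      (ENNReal.rpow_ne_top_of_nonneg (by positivity) hXt)).1 h5
  rw [seqNorm_eq hq0 hq]
  have : ∑' k, ‖a k‖ₑ ^ Q ≤ C ^ Q := by
    refine ENNReal.tsum_le_of_sum_range_le fun n => ?_
    have := ENNReal.rpow_le_rpow (key (Finset.range n)) hQ.le
    rwa [← ENNReal.rpow_mul, one_div_mul_cancel hQ.ne', ENNReal.rpow_one] at this
  calc _ ≤ (C ^ Q) ^ (1 / Q) := ENNReal.rpow_le_rpow this (by positivity)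
    _ = C := by rw [← ENNReal.rpow_mul, mul_one_div_cancel hQ.ne', ENNReal.rpow_one]

end QuatSchatten

/-! ### Bessel sequences and the variational Schatten norm. -/

namespace QuatSchatten

open MeasureTheory

section Bessel

variable {K : Type*} [NormedAddCommGroup K] [InnerProductSpace ℂ K]

local notation "⟪" x ", " y "⟫" => inner ℂ x y

/-- A sequence of vectors satisfying Bessel's inequality. -/
def IsBessel (f : ℕ → K) : Prop := ∀ x, ∑' k, ‖⟪f k, x⟫‖ₑ ^ 2 ≤ ‖x‖ₑ ^ 2

theorem sum_enorm_sq {ι E : Type*} [NormedAddCommGroup E] (s : Finset ι) (a : ι → E) :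
    ∑ k ∈ s, ‖a k‖ₑ ^ 2 = ENNReal.ofReal (∑ k ∈ s, ‖a k‖ ^ 2) := by
  rw [ENNReal.ofReal_sum_of_nonneg (fun _ _ => by positivity)]
  refine Finset.sum_congr rfl fun k _ => ?_
  rw [ENNReal.ofReal_pow (norm_nonneg _), ofReal_norm]

theorem isBessel_iff {f : ℕ → K} :
    IsBessel f ↔ ∀ (x : K) (s : Finset ℕ), ∑ k ∈ s, ‖⟪f k, x⟫‖ ^ 2 ≤ ‖x‖ ^ 2 := by
  refine forall_congr' fun x => ?_
  rw [ENNReal.tsum_eq_iSup_sum, iSup_le_iff]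
  refine forall_congr' fun s => ?_
  rw [sum_enorm_sq, ← ofReal_norm, ← ENNReal.ofReal_pow (norm_nonneg _),
    ENNReal.ofReal_le_ofReal_iff (by positivity)]

theorem IsBessel.norm_le_one {f : ℕ → K} (hf : IsBessel f) (k : ℕ) : ‖f k‖ ≤ 1 := by
  have h := isBessel_iff.1 hf (f k) {k}
  rw [Finset.sum_singleton, inner_self_eq_norm_sq_to_K] at h
  simp only [norm_pow, RCLike.norm_ofReal, abs_norm] at h
  by_contra! h1
  nlinarith [one_lt_pow₀ h1 two_ne_zero]

theorem IsBessel.enorm_le_one {f : ℕ → K} (hf : IsBessel f) (k : ℕ) : ‖f k‖ₑ ≤ 1 := by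
  rw [← ofReal_norm]
  exact ENNReal.ofReal_le_one.2 (hf.norm_le_one k)

theorem IsBessel.tsum_inner_le_one {f : ℕ → K} (hf : IsBessel f) {x : K} (hx : ‖x‖ₑ ≤ 1) :
    ∑' k, ‖⟪f k, x⟫‖ₑ ^ 2 ≤ 1 :=
  (hf x).trans (pow_le_one₀ zero_le hx)

theorem IsBessel.tsum_inner_le_one' {f : ℕ → K} (hf : IsBessel f) {x : K} (hx : ‖x‖ₑ ≤ 1) :
    ∑' k, ‖⟪x, f k⟫‖ₑ ^ 2 ≤ 1 := by
  simp_rw [← ofReal_norm, norm_inner_symm x, ofReal_norm]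
  exact hf.tsum_inner_le_one hx

/-- Zero vectors are allowed off `t`, so that singular vectors of finite rank operators can be
padded to full sequences. -/
theorem isBessel_of_orthonormal {f : ℕ → K} {t : Set ℕ} (h0 : ∀ k, k ∉ t → f k = 0)
    (hf : Orthonormal ℂ fun k : t => f k) : IsBessel f := by
  classical
  refine isBessel_iff.2 fun x s => ?_
  have h := hf.sum_inner_products_le x (s := s.subtype (· ∈ t))
  refine le_trans (le_of_eq ?_) h
  rw [Finset.sum_subtype_eq_sum_filter (f := fun k => ‖⟪f k, x⟫‖ ^ 2)]
  refine (Finset.sum_filter_of_ne fun k _ hk => ?_).symm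
  by_contra h1
  simp [h0 k h1] at hk

theorem isBessel_single {x : K} (hx : ‖x‖ ≤ 1) : IsBessel (Pi.single 0 x : ℕ → K) := by
  intro y
  rw [tsum_eq_single 0]
  · simp only [Pi.single_eq_same]
    gcongr
    rw [← ofReal_norm, ← ofReal_norm]
    refine ENNReal.ofReal_le_ofReal ((norm_inner_le_norm x y).trans ?_)
    exact mul_le_of_le_one_left (norm_nonneg _) hx
  · intro k hk
    simp [hk]

/-- The synthesis map is adjoint to the analysis map. Pairing the sum `y` with itself,
Cauchy–Schwarz and Bessel's inequality give `‖y‖⁴ ≤ (∑ ‖d k‖²) ‖y‖²`. -/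
theorem IsBessel.norm_sum_sq_le {f : ℕ → K} (hf : IsBessel f) (s : Finset ℕ) (d : ℕ → ℂ) :
    ‖∑ k ∈ s, d k • f k‖ ^ 2 ≤ ∑ k ∈ s, ‖d k‖ ^ 2 := by
  set y := ∑ k ∈ s, d k • f k with hy
  have h1 : ‖y‖ ^ 2 ≤ ∑ k ∈ s, ‖d k‖ * ‖⟪f k, y⟫‖ := by
    have : ‖y‖ ^ 2 = ‖⟪y, y⟫‖ := by
      rw [inner_self_eq_norm_sq_to_K]; simp
    rw [this]
    nth_rewrite 1 [hy]
    rw [sum_inner]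
    refine (norm_sum_le _ _).trans (le_of_eq (Finset.sum_congr rfl fun k _ => ?_))
    rw [inner_smul_left, norm_mul, RCLike.norm_conj]
  have h2 := Finset.sum_mul_sq_le_sq_mul_sq s (fun k => ‖d k‖) (fun k => ‖⟪f k, y⟫‖)
  have h3 := isBessel_iff.1 hf y s
  have h4 : 0 ≤ ∑ k ∈ s, ‖d k‖ ^ 2 := by positivity
  have h5 : (‖y‖ ^ 2) ^ 2 ≤ (∑ k ∈ s, ‖d k‖ ^ 2) * ‖y‖ ^ 2 :=
    calc (‖y‖ ^ 2) ^ 2 ≤ (∑ k ∈ s, ‖d k‖ * ‖⟪f k, y⟫‖) ^ 2 := by gcongr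
      _ ≤ _ := h2
      _ ≤ _ := by gcongr
  rcases eq_or_lt_of_le (sq_nonneg ‖y‖) with h6 | h6
  · rw [← h6]; exact h4
  · rw [sq] at h5
    exact le_of_mul_le_mul_right h5 h6

variable [CompleteSpace K]

theorem IsBessel.map {f : ℕ → K} (hf : IsBessel f) {W : K →L[ℂ] K} (hW : ‖W‖ ≤ 1) :
    IsBessel fun k => W (f k) := by
  refine isBessel_iff.2 fun x s => ?_
  simp only [← ContinuousLinearMap.adjoint_inner_right]
  refine (isBessel_iff.1 hf _ s).trans ?_
  gcongr
  refine (ContinuousLinearMap.le_opNorm _ _).trans ?_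
  rw [LinearIsometryEquiv.norm_map]
  exact mul_le_of_le_one_left (norm_nonneg _) hW

end Bessel

section VarNorm

variable {K : Type*} [NormedAddCommGroup K] [InnerProductSpace ℂ K]

local notation "⟪" x ", " y "⟫" => inner ℂ x y

/-- The Schatten norm of an operator on a complex Hilbert space, in its variational form. -/
noncomputable def varNorm (p : ℝ≥0∞) (T : K →L[ℂ] K) : ℝ≥0∞ :=
  ⨆ (f : ℕ → K) (g : ℕ → K) (_ : IsBessel f) (_ : IsBessel g), seqNorm p fun k => ⟪g k, T (f k)⟫

theorem varNorm_le_iff {p : ℝ≥0∞} {T : K →L[ℂ] K} {C : ℝ≥0∞} : varNorm p T ≤ C ↔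
    ∀ f g : ℕ → K, IsBessel f → IsBessel g → seqNorm p (fun k => ⟪g k, T (f k)⟫) ≤ C := by
  simp only [varNorm, iSup_le_iff]

theorem seqNorm_le_varNorm (p : ℝ≥0∞) (T : K →L[ℂ] K) {f g : ℕ → K} (hf : IsBessel f)
    (hg : IsBessel g) : seqNorm p (fun k => ⟪g k, T (f k)⟫) ≤ varNorm p T :=
  varNorm_le_iff.1 le_rfl f g hf hg

theorem varNorm_add_le {p : ℝ≥0∞} (hp : 1 ≤ p) (T S : K →L[ℂ] K) :
    varNorm p (T + S) ≤ varNorm p T + varNorm p S := by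
  refine varNorm_le_iff.2 fun f g hf hg => ?_
  simp only [add_apply, inner_add_right]
  refine (eLpNorm_add_le (measurable_of_countable _).aestronglyMeasurable
    (measurable_of_countable _).aestronglyMeasurable hp).trans ?_
  exact add_le_add (seqNorm_le_varNorm p T hf hg) (seqNorm_le_varNorm p S hf hg)

theorem varNorm_smul (p : ℝ≥0∞) (c : ℂ) (T : K →L[ℂ] K) :
    varNorm p (c • T) = ‖c‖ₑ * varNorm p T := by
  simp only [varNorm, ENNReal.mul_iSup]
  refine iSup_congr fun f => iSup_congr fun g => iSup_congr fun _ => iSup_congr fun _ => ?_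
  rw [seqNorm, seqNorm, ← eLpNorm_const_smul]
  congr 1
  ext k
  simp

theorem varNorm_zero (p : ℝ≥0∞) : varNorm p (0 : K →L[ℂ] K) = 0 := by
  simpa using varNorm_smul p 0 (0 : K →L[ℂ] K)

theorem enorm_inner_le_varNorm {p : ℝ≥0∞} (hp : p ≠ 0) (T : K →L[ℂ] K) {x y : K} (hx : ‖x‖ ≤ 1)
    (hy : ‖y‖ ≤ 1) : ‖⟪y, T x⟫‖ₑ ≤ varNorm p T := by
  have := enorm_le_seqNorm hp (fun k => ⟪(Pi.single 0 y : ℕ → K) k, T ((Pi.single 0 x : ℕ → K) k)⟫) 0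
  refine le_trans (by simp) (this.trans
    (seqNorm_le_varNorm p T (isBessel_single hx) (isBessel_single hy)))

theorem opNorm_le_of_inner {T : K →L[ℂ] K} {C : ℝ} (hC : 0 ≤ C)
    (h : ∀ x y, ‖⟪y, T x⟫‖ ≤ C * ‖x‖ * ‖y‖) : ‖T‖ ≤ C := by
  refine T.opNorm_le_bound hC fun x => ?_
  have h1 := h x (T x)
  rw [inner_self_eq_norm_sq_to_K] at h1
  simp only [norm_pow, RCLike.norm_ofReal, abs_norm] at h1
  rcases eq_or_lt_of_le (norm_nonneg (T x)) with h2 | h2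
  · rw [← h2]; positivity
  · rw [sq] at h1
    exact le_of_mul_le_mul_right h1 h2

/-- Bessel pairs with one nonzero term already see every matrix entry `⟪y, T x⟫` with `x`, `y` in
the unit ball. -/
theorem enorm_le_varNorm {p : ℝ≥0∞} (hp : p ≠ 0) (T : K →L[ℂ] K) : ‖T‖ₑ ≤ varNorm p T := by
  rcases eq_or_ne (varNorm p T) ∞ with ht | ht
  · rw [ht]; exact le_top
  rw [← ofReal_norm]
  refine ENNReal.ofReal_le_of_le_toReal (opNorm_le_of_inner ENNReal.toReal_nonneg fun x y => ?_)
  rcases eq_or_ne x 0 with rfl | hx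
  · simp
  rcases eq_or_ne y 0 with rfl | hy
  · simp
  have h := ENNReal.toReal_mono ht (enorm_inner_le_varNorm hp T
    (x := ((‖x‖⁻¹ : ℝ) : ℂ) • x) (y := ((‖y‖⁻¹ : ℝ) : ℂ) • y)
    (by simp [norm_smul, hx]) (by simp [norm_smul, hy]))
  rw [toReal_enorm, map_smul, inner_smul_left, inner_smul_right] at h
  have hx' : 0 < ‖x‖ := norm_pos_iff.2 hx
  have hy' : 0 < ‖y‖ := norm_pos_iff.2 hy
  simp only [norm_mul, RCLike.norm_conj, Complex.norm_real, norm_inv, norm_norm] at h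
  rw [← mul_assoc, ← mul_inv, inv_mul_le_iff₀ (by positivity)] at h
  linarith

theorem varNorm_eq_zero {p : ℝ≥0∞} (hp : p ≠ 0) {T : K →L[ℂ] K} (h : varNorm p T = 0) : T = 0 := by
  have := enorm_le_varNorm hp T
  rw [h, nonpos_iff_eq_zero, ← ofReal_norm, ENNReal.ofReal_eq_zero] at this
  exact norm_le_zero_iff.1 this

/-- This lets the exponent `q = ∞`, dual to `p = 1`, be treated together with the finite ones. -/
theorem varNorm_top (T : K →L[ℂ] K) : varNorm ∞ T = ‖T‖ₑ := by
  refine le_antisymm (varNorm_le_iff.2 fun f g hf hg => seqNorm_top_le fun n => ?_)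
    (enorm_le_varNorm (by simp) T)
  rw [← ofReal_norm, ← ofReal_norm]
  refine ENNReal.ofReal_le_ofReal ((norm_inner_le_norm _ _).trans ?_)
  calc ‖g n‖ * ‖T (f n)‖ ≤ 1 * (‖T‖ * 1) := by
        gcongr
        · exact hg.norm_le_one n
        · exact (T.le_opNorm _).trans (by gcongr; exact hf.norm_le_one n)
    _ = ‖T‖ := by ring

/-- `T = ∑ₙ lₙ ⟨eₙ, ·⟩ σₙ`. -/
def IsExpansion (T : K →L[ℂ] K) (l : ℕ → ℂ) (e σ : ℕ → K) : Prop :=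
  ∀ x, HasSum (fun n => (l n * ⟪e n, x⟫) • σ n) (T x)

theorem IsExpansion.hasSum_inner {T : K →L[ℂ] K} {l : ℕ → ℂ} {e σ : ℕ → K}
    (hT : IsExpansion T l e σ) (x y : K) :
    HasSum (fun n => l n * ⟪e n, x⟫ * ⟪y, σ n⟫) ⟪y, T x⟫ := by
  have := (hT x).mapL (innerSL ℂ y)
  simpa [inner_smul_right] using this

/-- The entry `⟪g k, T (f k)⟫` is `∑ₙ lₙ ⟪eₙ, f k⟫ ⟪g k, σₙ⟫`, and the Bessel property of the four
sequences supplies the row and column bounds of the Schur test. Neither orthogonality nor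
monotonicity is needed, so the bound also covers truncations and finite sums of rank one operators.
-/
theorem IsExpansion.varNorm_le {T : K →L[ℂ] K} {l : ℕ → ℂ} {e σ : ℕ → K}
    (hT : IsExpansion T l e σ) (he : IsBessel e) (hσ : IsBessel σ) {p : ℝ≥0∞} (hp : 1 ≤ p)
    (hp' : p ≠ ∞) : varNorm p T ≤ seqNorm p l := by
  have hp0 : p ≠ 0 := (zero_lt_one.trans_le hp).ne'
  have hP : 1 ≤ p.toReal := by simpa using ENNReal.toReal_mono hp' hp
  refine varNorm_le_iff.2 fun f g hf hg => ?_
  rw [seqNorm_eq hp0 hp', seqNorm_eq hp0 hp']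
  refine ENNReal.rpow_le_rpow ?_ (by positivity)
  refine le_trans ?_ (tsum_rpow_tsum_mul_le (α := fun k n => ‖⟪e n, f k⟫‖ₑ)
    (β := fun k n => ‖⟪g k, σ n⟫‖ₑ) (l := fun n => ‖l n‖ₑ)
    (fun k => he.tsum_inner_le_one (hf.enorm_le_one k))
    (fun n => hf.tsum_inner_le_one' (he.enorm_le_one n))
    (fun k => hσ.tsum_inner_le_one' (hg.enorm_le_one k))
    (fun n => hg.tsum_inner_le_one (hσ.enorm_le_one n)) hP)
  refine ENNReal.tsum_le_tsum fun k => ENNReal.rpow_le_rpow ?_ (by linarith)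
  rw [← (hT.hasSum_inner (f k) (g k)).tsum_eq]
  refine enorm_tsum_le_tsum_enorm.trans (le_of_eq (tsum_congr fun n => ?_))
  rw [enorm_mul, enorm_mul, mul_comm ‖l n‖ₑ, mul_right_comm]

end VarNorm

end QuatSchatten

/-! ### Compact operators: a matrix-entry criterion and attainment of the norm. -/

namespace QuatSchatten

open MeasureTheory Filter Topology InnerProductSpace

section Compact

variable {K : Type*} [NormedAddCommGroup K] [InnerProductSpace ℂ K] [CompleteSpace K]

local notation "⟪" x ", " y "⟫" => inner ℂ x y

omit [CompleteSpace K] in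
theorem isCompactOperator_starProjection (F : Submodule ℂ K) [FiniteDimensional ℂ F] :
    IsCompactOperator F.starProjection :=
  (isCompactOperator_of_locallyCompactSpace_rng F.subtypeL).comp_clm F.orthogonalProjectionOnto

/-- An operator that is not compact has uniformly large matrix entries along two orthonormal
sequences. -/
theorem exists_orthonormal_of_not_isCompactOperator {T : K →L[ℂ] K} (hT : ¬ IsCompactOperator T) :
    ∃ ε > 0, ∃ f g : ℕ → K, Orthonormal ℂ f ∧ Orthonormal ℂ g ∧ ∀ n, ε ≤ ‖⟪g n, T (f n)⟫‖ := by
  classical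
  -- Large entries persist orthogonally to any finite set of vectors. Otherwise, with `Q` the
  -- projection onto the orthogonal complement of their span, `Q T Q` has norm below `ε` while `T -
  -- Q T Q` is compact; the compact operators being closed, `T` would be compact.
  have key : ∃ ε > 0, ∀ s : Finset (K × K), ∃ y : K × K, (y.1 ≠ 0 ∧ y.2 ≠ 0 ∧
      ε * ‖y.1‖ * ‖y.2‖ ≤ ‖⟪y.2, T y.1⟫‖) ∧ ∀ x ∈ s, ⟪x.1, y.1⟫ = 0 ∧ ⟪x.2, y.2⟫ = 0 := by
    by_contra! h
    refine hT ((isClosed_setOfPred_isCompactOperator (σ₁₂ := RingHom.id ℂ)).closure_subset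
      (Metric.mem_closure_iff.2 fun ε hε => ?_) : T ∈ {f : K →L[ℂ] K | IsCompactOperator f})
    obtain ⟨s, hs⟩ := h (ε / 2) (by positivity)
    let F : Submodule ℂ K := Submodule.span ℂ
      ((s.image Prod.fst ∪ s.image Prod.snd : Finset K) : Set K)
    let P : K →L[ℂ] K := F.starProjection
    have hP : IsCompactOperator P := isCompactOperator_starProjection F
    let Q : K →L[ℂ] K := Fᗮ.starProjection
    have hQ : ∀ x, Q x = x - P x := fun x => by
      simp only [Q, P, Submodule.starProjection_orthogonal_val]
    refine ⟨T - Q ∘L T ∘L Q, ?_, ?_⟩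
    · have h1 : T - Q ∘L T ∘L Q = P ∘L T + (Q ∘L T) ∘L P := by
        ext x
        simp [hQ]
        abel
      rw [h1]
      exact (hP.comp_clm T).add (hP.clm_comp (Q ∘L T))
    · rw [dist_eq_norm, sub_sub_cancel]
      refine lt_of_le_of_lt (opNorm_le_of_inner (C := ε / 2) (by positivity) fun x y => ?_)
        (half_lt_self hε)
      have h2 : ⟪y, (Q ∘L T ∘L Q) x⟫ = ⟪Q y, T (Q x)⟫ := by
        simp only [Q, ContinuousLinearMap.comp_apply]
        rw [Submodule.inner_starProjection_left_eq_right]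
      have hQn : ∀ z, ‖Q z‖ ≤ ‖z‖ := fun z => Submodule.norm_starProjection_apply_le _ z
      rw [h2]
      have hor : ∀ z : K, ∀ w ∈ F, ⟪w, Q z⟫ = 0 := fun z w hw =>
        (Submodule.mem_orthogonal F _).1 (Submodule.starProjection_apply_mem _ z) w hw
      rcases eq_or_ne (Q x) 0 with hx | hx
      · rw [hx]; simp; positivity
      rcases eq_or_ne (Q y) 0 with hy | hy
      · rw [hy]; simp; positivity
      by_contra! h3
      obtain ⟨w, hw, hw'⟩ := hs (Q x, Q y) ⟨hx, hy, le_trans (by gcongr <;> exact hQn _) h3.le⟩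
      refine hw' (hor x _ (Submodule.subset_span ?_)) (hor y _ (Submodule.subset_span ?_))
      · simp only [Finset.coe_union, Finset.coe_image]
        exact Or.inl ⟨w, hw, rfl⟩
      · simp only [Finset.coe_union, Finset.coe_image]
        exact Or.inr ⟨w, hw, rfl⟩
  obtain ⟨ε, hε, h⟩ := key
  obtain ⟨F, hF1, hF2⟩ := exists_seq_of_forall_finset_exists _ _ fun s _ => h s
  have hne1 := fun n => (hF1 n).1
  have hne2 := fun n => (hF1 n).2.1
  refine ⟨ε, hε, fun n => ((‖(F n).1‖⁻¹ : ℝ) : ℂ) • (F n).1,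
    fun n => ((‖(F n).2‖⁻¹ : ℝ) : ℂ) • (F n).2, ⟨fun n => ?_, ?_⟩, ⟨fun n => ?_, ?_⟩, fun n => ?_⟩
  · simp [norm_smul, hne1 n]
  · intro m n hmn
    simp only [inner_smul_left, inner_smul_right]
    rcases lt_or_gt_of_ne hmn with h1 | h1
    · simp [(hF2 m n h1).1]
    · rw [← inner_conj_symm]; simp [(hF2 n m h1).1]
  · simp [norm_smul, hne2 n]
  · intro m n hmn
    simp only [inner_smul_left, inner_smul_right]
    rcases lt_or_gt_of_ne hmn with h1 | h1
    · simp [(hF2 m n h1).2]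
    · rw [← inner_conj_symm]; simp [(hF2 n m h1).2]
  · have h1 := norm_pos_iff.2 (hne1 n)
    have h2 := norm_pos_iff.2 (hne2 n)
    rw [map_smul, inner_smul_left, inner_smul_right]
    simp only [norm_mul, RCLike.norm_conj, Complex.norm_real, norm_inv, norm_norm]
    rw [← mul_assoc, ← mul_inv, le_inv_mul_iff₀ (by positivity)]
    have := (hF1 n).2.2
    linarith

omit [CompleteSpace K] in
theorem isBessel_of_orthonormal' {f : ℕ → K} (hf : Orthonormal ℂ f) : IsBessel f :=
  isBessel_iff.2 fun _ _ => hf.sum_inner_products_le _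

/-- For a noncompact operator there are orthonormal sequences along which the entries stay above
some `ε > 0`, and such a sequence of entries is not in `ℓ^p` for `p < ∞`. -/
theorem isCompactOperator_of_varNorm_ne_top {p : ℝ≥0∞} (hp : p ≠ 0) (hp' : p ≠ ∞)
    {T : K →L[ℂ] K} (hT : varNorm p T ≠ ∞) : IsCompactOperator T := by
  by_contra h
  obtain ⟨ε, hε, f, g, hf, hg, hfg⟩ := exists_orthonormal_of_not_isCompactOperator h
  refine hT (top_unique (le_trans (le_of_eq ?_) (seqNorm_le_varNorm p T
    (isBessel_of_orthonormal' hf) (isBessel_of_orthonormal' hg))))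
  have h0 := ENNReal.toReal_pos hp hp'
  rw [seqNorm_eq hp hp', eq_comm, ENNReal.rpow_eq_top_iff_of_pos (by positivity)]
  refine top_unique (le_trans (le_of_eq ?_) (ENNReal.tsum_le_tsum
    (f := fun _ : ℕ => ENNReal.ofReal ε ^ p.toReal) fun n => ?_))
  · rw [ENNReal.tsum_const_eq_top_of_ne_zero]
    exact (ENNReal.rpow_pos (by simpa using hε) (by simp)).ne'
  · gcongr
    rw [← ofReal_norm]
    exact ENNReal.ofReal_le_ofReal (hfg n)

/-- A compact operator attains its norm. -/
theorem exists_inner_eq_norm {T : K →L[ℂ] K} (hT : IsCompactOperator T) :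
    ∃ e σ : K, T e = (‖T‖ : ℂ) • σ ∧ (∀ x, ⟪σ, T x⟫ = ‖T‖ * ⟪e, x⟫) ∧
      (T = 0 → e = 0 ∧ σ = 0) ∧ (T ≠ 0 → ‖e‖ = 1 ∧ ‖σ‖ = 1) := by
  rcases eq_or_ne T 0 with rfl | h0
  · exact ⟨0, 0, by simp⟩
  have hl : 0 < ‖T‖ := norm_pos_iff.2 h0
  set l := ‖T‖ with hldef
  obtain ⟨x, hx1, hx2⟩ : ∃ x : ℕ → K, (∀ n, ‖x n‖ ≤ 1) ∧ Tendsto (fun n => ‖T (x n)‖) atTop (𝓝 l) := by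
    obtain ⟨u, -, hu, hu'⟩ := exists_seq_tendsto_sSup
      (S := (fun x => ‖T x‖) '' Metric.closedBall 0 1) ⟨_, 0, by simp, rfl⟩
      ⟨‖T‖, by rintro _ ⟨x, hx, rfl⟩; exact T.unit_le_opNorm x (by simpa using hx)⟩
    choose x hx hx' using hu'
    rw [ContinuousLinearMap.sSup_unitClosedBall_eq_norm] at hu
    exact ⟨x, fun n => by simpa using hx n, by simpa only [hx'] using hu⟩
  obtain ⟨C, hC, hC'⟩ := hT.image_closedBall_subset_compact (𝕜₁ := ℂ) (f := (T : K →ₗ[ℂ] K)) 1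
  obtain ⟨y, -, φ, hφ, hy⟩ := hC.tendsto_subseq (x := fun n => T (x n))
    fun n => hC' ⟨x n, by simpa using hx1 n, rfl⟩
  have hyn : ‖y‖ = l := tendsto_nhds_unique hy.norm (hx2.comp hφ.tendsto_atTop)
  let A := ContinuousLinearMap.adjoint T
  have hA : ‖A y‖ ≤ l * l := by
    refine (A.le_opNorm y).trans (le_of_eq ?_)
    rw [hyn, LinearIsometryEquiv.norm_map]
  have hlC : (l : ℂ) ≠ 0 := by exact_mod_cast hl.ne'
  let e : K := ((l : ℂ) ^ 2)⁻¹ • A y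
  have hAe : A y = (l : ℂ) ^ 2 • e := by
    simp only [e]; rw [smul_smul, mul_inv_cancel₀ (pow_ne_zero 2 hlC), one_smul]
  -- The maximizing sequence itself converges, to `l⁻² T* y`: since `‖T* y‖ ≤ l²`, `‖x n‖ ≤ 1` and
  -- `Re ⟪y, T (x n)⟫ → l²` along `φ`, expanding the square bounds it by a sequence tending to `l⁴ -
  -- 2l⁴ + l⁴ = 0`.
  have hsq : Tendsto (fun n => ‖A y - (l : ℂ) ^ 2 • x (φ n)‖ ^ 2) atTop (𝓝 0) := by
    have hlim : Tendsto (fun n => (l * l) ^ 2 - 2 * (l ^ 2 * RCLike.re ⟪y, T (x (φ n))⟫) +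
        (l ^ 2) ^ 2) atTop (𝓝 ((l * l) ^ 2 - 2 * (l ^ 2 * RCLike.re ⟪y, y⟫) + (l ^ 2) ^ 2)) := by
      have h1 : Tendsto (fun n => RCLike.re ⟪y, T (x (φ n))⟫) atTop (𝓝 (RCLike.re ⟪y, y⟫)) :=
        (RCLike.continuous_re.tendsto _).comp (tendsto_const_nhds.inner hy)
      exact (tendsto_const_nhds.sub ((h1.const_mul _).const_mul _)).add tendsto_const_nhds
    have h2 : (l * l) ^ 2 - 2 * (l ^ 2 * RCLike.re ⟪y, y⟫) + (l ^ 2) ^ 2 = 0 := by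
      rw [inner_self_eq_norm_sq, hyn]; ring
    rw [h2] at hlim
    refine squeeze_zero (fun _ => by positivity) (fun n => ?_) hlim
    rw [@norm_sub_sq ℂ, inner_smul_right, ContinuousLinearMap.adjoint_inner_left]
    have h3 : RCLike.re ((l : ℂ) ^ 2 * ⟪y, T (x (φ n))⟫) = l ^ 2 * RCLike.re ⟪y, T (x (φ n))⟫ := by
      rw [← Complex.ofReal_pow]; exact Complex.re_ofReal_mul _ _
    rw [h3, norm_smul]
    have h4 : ‖(l : ℂ) ^ 2‖ * ‖x (φ n)‖ ≤ l ^ 2 := by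
      rw [norm_pow, Complex.norm_real, Real.norm_of_nonneg hl.le]
      exact mul_le_of_le_one_right (by positivity) (hx1 _)
    gcongr
  have hxe : Tendsto (fun n => x (φ n)) atTop (𝓝 e) := by
    have h1 : Tendsto (fun n => ‖A y - (l : ℂ) ^ 2 • x (φ n)‖) atTop (𝓝 0) := by
      have := hsq.sqrt
      simpa [Real.sqrt_sq (norm_nonneg _)] using this
    have h2 := (tendsto_zero_iff_norm_tendsto_zero.2 h1).const_smul (((l : ℂ) ^ 2)⁻¹)
    have h3 : Tendsto (fun n => e - x (φ n)) atTop (𝓝 0) := by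
      refine (h2.congr fun n => ?_).trans (by rw [smul_zero])
      rw [smul_sub, smul_smul, inv_mul_cancel₀ (pow_ne_zero 2 hlC), one_smul]
    simpa using (tendsto_const_nhds (x := e)).sub h3
  have hTe : T e = y := tendsto_nhds_unique ((T.continuous.tendsto e).comp hxe) hy
  have he : ‖e‖ = 1 := by
    refine le_antisymm (le_of_tendsto' hxe.norm fun n => hx1 _) ?_
    have := T.le_opNorm e
    rw [hTe, hyn] at this
    exact le_of_mul_le_mul_left (by linarith) hl
  refine ⟨e, ((l : ℂ))⁻¹ • y, ?_, fun x => ?_, fun h => absurd h h0, fun _ => ⟨he, ?_⟩⟩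
  · rw [hTe, smul_smul, mul_inv_cancel₀ hlC, one_smul]
  · rw [inner_smul_left, ← ContinuousLinearMap.adjoint_inner_left]
    change _ * ⟪A y, x⟫ = _
    rw [hAe, inner_smul_left]
    simp only [map_inv₀, Complex.conj_ofReal, map_pow]
    field_simp
  · rw [norm_smul, norm_inv, Complex.norm_real, Real.norm_of_nonneg hl.le, hyn,
      inv_mul_cancel₀ hl.ne']

end Compact

end QuatSchatten

/-! ### Singular value decomposition on a complex Hilbert space. -/

namespace QuatSchatten

open MeasureTheory Filter Topology InnerProductSpace

section SVD

variable {K : Type*} [NormedAddCommGroup K] [InnerProductSpace ℂ K]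

local notation "⟪" x ", " y "⟫" => inner ℂ x y

/-- A singular value decomposition `T = ∑ₙ lₙ ⟨eₙ, ·⟩ σₙ`, with `eₙ = σₙ = 0` when `lₙ = 0`. -/
structure IsSVD (T : K →L[ℂ] K) (l : ℕ → ℝ) (e σ : ℕ → K) : Prop where
  antitone : Antitone l
  nonneg : ∀ n, 0 ≤ l n
  inner_left : ∀ m n, ⟪e m, e n⟫ = if m = n ∧ l m ≠ 0 then 1 else 0
  inner_right : ∀ m n, ⟪σ m, σ n⟫ = if m = n ∧ l m ≠ 0 then 1 else 0
  expansion : IsExpansion T (fun n => (l n : ℂ)) e σ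

theorem isBessel_of_inner {e : ℕ → K} {l : ℕ → ℝ}
    (h : ∀ m n, ⟪e m, e n⟫ = if m = n ∧ l m ≠ 0 then 1 else 0) : IsBessel e := by
  refine isBessel_of_orthonormal (t := {n | l n ≠ 0}) (fun k hk => ?_) ?_
  · have := h k k
    simp only [Set.mem_ofPred_eq, not_not] at hk
    simpa [hk] using this
  · classical
    rw [orthonormal_iff_ite]
    rintro ⟨m, hm⟩ ⟨n, hn⟩
    rw [h m n]
    have : l m ≠ 0 := hm
    simp [this]

theorem IsSVD.isBessel_left {T : K →L[ℂ] K} {l : ℕ → ℝ} {e σ : ℕ → K} (h : IsSVD T l e σ) :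
    IsBessel e := isBessel_of_inner h.inner_left

theorem IsSVD.isBessel_right {T : K →L[ℂ] K} {l : ℕ → ℝ} {e σ : ℕ → K} (h : IsSVD T l e σ) :
    IsBessel σ := isBessel_of_inner h.inner_right

theorem IsSVD.inner_apply {T : K →L[ℂ] K} {l : ℕ → ℝ} {e σ : ℕ → K} (h : IsSVD T l e σ) (n : ℕ) :
    ⟪σ n, T (e n)⟫ = l n := by
  have h1 := h.expansion.hasSum_inner (e n) (σ n)
  refine h1.unique ?_
  have h2 : (l n : ℂ) * ⟪e n, e n⟫ * ⟪σ n, σ n⟫ = l n := by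
    rw [h.inner_left, h.inner_right]
    by_cases h0 : l n = 0 <;> simp [h0]
  have h3 := hasSum_single (f := fun m => (l m : ℂ) * ⟪e m, e n⟫ * ⟪σ n, σ m⟫) n fun m hm => by
    rw [h.inner_left]
    simp [hm]
  rwa [h2] at h3

/-- The singular vectors form an extremal Bessel pair: their matrix entries are exactly the `l n`.
-/
theorem IsSVD.varNorm_eq {T : K →L[ℂ] K} {l : ℕ → ℝ} {e σ : ℕ → K} (h : IsSVD T l e σ) {p : ℝ≥0∞}
    (hp : 1 ≤ p) (hp' : p ≠ ∞) : varNorm p T = seqNorm p fun n => (l n : ℂ) := by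
  refine le_antisymm (h.expansion.varNorm_le h.isBessel_left h.isBessel_right hp hp') ?_
  simpa only [h.inner_apply] using seqNorm_le_varNorm p T h.isBessel_left h.isBessel_right

variable [CompleteSpace K]

/-- Every compact operator on a complex Hilbert space has a singular value decomposition. -/
theorem exists_isSVD {T : K →L[ℂ] K} (hT : IsCompactOperator T) : ∃ l e σ, IsSVD T l e σ := by
  classical
  -- Compactness is a premise inside the existential, so that the choice functions are total and the
  -- recursion can be written before its terms are known to be compact.
  have hex : ∀ A : K →L[ℂ] K, ∃ e σ : K, IsCompactOperator A → A e = (‖A‖ : ℂ) • σ ∧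
      (∀ x, ⟪σ, A x⟫ = ‖A‖ * ⟪e, x⟫) ∧ (A = 0 → e = 0 ∧ σ = 0) ∧ (A ≠ 0 → ‖e‖ = 1 ∧ ‖σ‖ = 1) := by
    intro A
    by_cases hA : IsCompactOperator A
    · obtain ⟨e, σ, h⟩ := exists_inner_eq_norm hA
      exact ⟨e, σ, fun _ => h⟩
    · exact ⟨0, 0, fun h => absurd h hA⟩
  choose E S hES using hex
  -- Deflation: each step removes the leading singular term, and the norms of the successive
  -- remainders are the singular values.
  let R : (K →L[ℂ] K) → (K →L[ℂ] K) := fun A => A - (‖A‖ : ℂ) • rankOne ℂ (S A) (E A)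
  let A : ℕ → (K →L[ℂ] K) := fun n => R^[n] T
  have hAs : ∀ n x, A (n + 1) x = A n x - (‖A n‖ * ⟪E (A n), x⟫) • S (A n) := fun n x => by
    simp only [A, Function.iterate_succ_apply', R]
    simp [mul_smul]
  have hAc : ∀ n, IsCompactOperator (A n) := by
    intro n
    induction n with
    | zero => exact hT
    | succ n ih =>
      have h1 : IsCompactOperator (rankOne ℂ (S (A n)) (E (A n))) := by
        rw [rankOne_def']
        exact (isCompactOperator_of_locallyCompactSpace_dom (innerSL ℂ (E (A n)))).clm_comp
          (ContinuousLinearMap.toSpanSingleton ℂ (S (A n)))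
      have h2 : A (n + 1) = A n - (‖A n‖ : ℂ) • rankOne ℂ (S (A n)) (E (A n)) := by
        simp only [A, Function.iterate_succ_apply', R]
      rw [h2]
      exact ih.sub (h1.smul (‖A n‖ : ℂ))
  let l : ℕ → ℝ := fun n => ‖A n‖
  let e : ℕ → K := fun n => E (A n)
  let σ : ℕ → K := fun n => S (A n)
  have hAe : ∀ n, A n (e n) = (l n : ℂ) • σ n := fun n => (hES (A n) (hAc n)).1
  have hAσ : ∀ n x, ⟪σ n, A n x⟫ = l n * ⟪e n, x⟫ := fun n => (hES (A n) (hAc n)).2.1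
  have hl0 : ∀ n, l n = 0 → e n = 0 ∧ σ n = 0 := fun n h =>
    (hES (A n) (hAc n)).2.2.1 (norm_eq_zero.1 h)
  have hl1 : ∀ n, l n ≠ 0 → ‖e n‖ = 1 ∧ ‖σ n‖ = 1 := fun n h =>
    (hES (A n) (hAc n)).2.2.2 (fun h0 => h (by simp [l, h0]))
  have hAs' : ∀ n x, A (n + 1) x = A n x - (l n * ⟪e n, x⟫) • σ n := hAs
  have hee : ∀ n, ⟪e n, e n⟫ = if l n ≠ 0 then 1 else 0 := fun n => by
    by_cases h : l n = 0
    · simp [h, (hl0 n h).1]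
    · rw [inner_self_eq_norm_sq_to_K, (hl1 n h).1]; simp [h]
  have hσσ : ∀ n, ⟪σ n, σ n⟫ = if l n ≠ 0 then 1 else 0 := fun n => by
    by_cases h : l n = 0
    · simp [h, (hl0 n h).2]
    · rw [inner_self_eq_norm_sq_to_K, (hl1 n h).2]; simp [h]
  have hlee : ∀ n, (l n : ℂ) * ⟪e n, e n⟫ = l n := fun n => by
    rw [hee]; by_cases h : l n = 0 <;> simp [h]
  have hlσσ : ∀ n, (l n : ℂ) * ⟪σ n, σ n⟫ = l n := fun n => by
    rw [hσσ]; by_cases h : l n = 0 <;> simp [h]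
  have hlx : ∀ n (z : ℂ), l n * z = 0 → (l n ≠ 0 → z = 0) := fun n z h hn =>
    (mul_eq_zero.1 h).resolve_left (by exact_mod_cast hn)
  -- The invariant of the recursion: a remainder kills the earlier `e m` and has range orthogonal to
  -- the earlier `σ m`. Orthogonality of the new vectors to the old ones follows.
  have inv : ∀ n m, m < n → A n (e m) = 0 ∧ ∀ x, ⟪σ m, A n x⟫ = 0 := by
    intro n
    induction n with
    | zero => intro m hm; exact absurd hm (Nat.not_lt_zero m)
    | succ n ih =>
      intro m hm
      rcases Nat.lt_succ_iff_lt_or_eq.1 hm with h | rfl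
      · obtain ⟨h1, h2⟩ := ih m h
        refine ⟨?_, fun x => ?_⟩
        · rw [hAs', h1, ← hAσ, h1]; simp
        · have h3 := h2 (e n)
          rw [hAe, inner_smul_right] at h3
          rw [hAs', inner_sub_right, h2, inner_smul_right, mul_right_comm, h3]
          simp
      · refine ⟨?_, fun x => ?_⟩
        · rw [hAs', hAe, hlee, sub_self]
        · rw [hAs', inner_sub_right, hAσ, inner_smul_right, mul_right_comm, hlσσ, sub_self]
  have heo : ∀ m n, m < n → ⟪e n, e m⟫ = 0 := fun m n h => by
    by_cases h0 : l n = 0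
    · simp [(hl0 n h0).1]
    · refine hlx n _ ?_ h0
      rw [← hAσ, (inv n m h).1, inner_zero_right]
  have hσo : ∀ m n, m < n → ⟪σ m, σ n⟫ = 0 := fun m n h => by
    by_cases h0 : l n = 0
    · simp [(hl0 n h0).2]
    · refine hlx n _ ?_ h0
      rw [← inner_smul_right, ← hAe, (inv n m h).2]
  have hel : ∀ m n, ⟪e m, e n⟫ = if m = n ∧ l m ≠ 0 then 1 else 0 := fun m n => by
    rcases lt_trichotomy m n with h | rfl | h
    · rw [← inner_conj_symm, heo m n h]; simp [h.ne]
    · rw [hee]; simp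
    · rw [heo n m h]; simp [h.ne']
  have hσl : ∀ m n, ⟪σ m, σ n⟫ = if m = n ∧ l m ≠ 0 then 1 else 0 := fun m n => by
    rcases lt_trichotomy m n with h | rfl | h
    · rw [hσo m n h]; simp [h.ne]
    · rw [hσσ]; simp
    · rw [← inner_conj_symm, hσo n m h]; simp [h.ne']
  have heB : IsBessel e := isBessel_of_inner hel
  have hTA : ∀ n x, (∀ m < n, ⟪e m, x⟫ = 0) → T x = A n x := by
    intro n
    induction n with
    | zero => intro x _; rfl
    | succ n ih =>
      intro x hx
      rw [hAs', hx n (Nat.lt_succ_self n), ih x fun m hm => hx m (hm.trans (Nat.lt_succ_self n))]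
      simp
  have hTe : ∀ n, T (e n) = (l n : ℂ) • σ n := fun n => by
    rw [hTA n (e n) (fun m hm => by rw [← inner_conj_symm, heo m n hm, map_zero]), hAe]
  have hl : Antitone l := by
    refine antitone_nat_of_succ_le fun n => ?_
    refine ContinuousLinearMap.opNorm_le_bound _ (norm_nonneg _) fun x => ?_
    -- A deflation step is precomposition with the contraction that removes the `e n` component, so
    -- the norm cannot grow.
    have h1 : A (n + 1) x = A n (x - ⟪e n, x⟫ • e n) := by
      rw [hAs', map_sub, map_smul, hAe, smul_smul, mul_comm]
    rw [h1]
    refine (ContinuousLinearMap.le_opNorm _ _).trans (mul_le_mul_of_nonneg_left ?_ (norm_nonneg _))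
    refine (sq_le_sq₀ (norm_nonneg _) (norm_nonneg _)).1 ?_
    rw [@norm_sub_sq ℂ, inner_smul_right, norm_smul, ← inner_conj_symm x, RCLike.mul_conj]
    have h2 := heB.norm_le_one n
    have h3 : RCLike.re ((‖⟪e n, x⟫‖ : ℂ) ^ 2) = ‖⟪e n, x⟫‖ ^ 2 := by
      rw [← Complex.ofReal_pow]; exact Complex.ofReal_re _
    have h4 : (‖⟪e n, x⟫‖ * ‖e n‖) ^ 2 ≤ ‖⟪e n, x⟫‖ ^ 2 := by
      gcongr; exact mul_le_of_le_one_right (norm_nonneg _) h2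
    have h5 := sq_nonneg ‖⟪e n, x⟫‖
    erw [h3]
    linarith
  -- If all `l n ≥ ε`, the vectors `T (e n) = l n • σ n` are pairwise orthogonal of norm at least
  -- `ε`, so no subsequence is Cauchy, contradicting compactness.
  have hlim : ∀ ε > 0, ∃ n, l n < ε := by
    by_contra! h
    obtain ⟨ε, hε, h⟩ := h
    obtain ⟨C, hC, hC'⟩ := hT.image_closedBall_subset_compact (𝕜₁ := ℂ) (f := (T : K →ₗ[ℂ] K)) 1
    obtain ⟨y, -, φ, hφ, hy⟩ := hC.tendsto_subseq (x := fun n => T (e n))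
      fun n => hC' ⟨e n, by simpa using heB.norm_le_one n, rfl⟩
    obtain ⟨N, hN⟩ := Metric.cauchySeq_iff.1 hy.cauchySeq ε hε
    have h1 := hN N le_rfl (N + 1) (Nat.le_succ N)
    simp only [Function.comp_apply, dist_eq_norm, hTe] at h1
    have hlt : φ N < φ (N + 1) := hφ (Nat.lt_succ_self N)
    have h2 : ‖(l (φ N) : ℂ) • σ (φ N) - (l (φ (N + 1)) : ℂ) • σ (φ (N + 1))‖ ^ 2
        = l (φ N) ^ 2 + l (φ (N + 1)) ^ 2 := by
      have hn : ∀ k, ‖(l k : ℂ) • σ k‖ = l k := fun k => by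
        rw [norm_smul, (hl1 k (hε.trans_le (h k)).ne').2, Complex.norm_real,
          Real.norm_of_nonneg (norm_nonneg _), mul_one]
      rw [@norm_sub_sq ℂ, inner_smul_left, inner_smul_right, hσo _ _ hlt, hn, hn]
      simp
    have h3 := h (φ N)
    have h4 := norm_nonneg ((l (φ N) : ℂ) • σ (φ N) - (l (φ (N + 1)) : ℂ) • σ (φ (N + 1)))
    nlinarith [sq_nonneg (l (φ (N + 1)))]
  refine ⟨l, e, σ, hl, fun n => norm_nonneg _, hel, hσl, fun x => ?_⟩
  rw [HasSum, SummationFilter.unconditional_filter, Metric.tendsto_atTop]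
  intro ε hε
  -- Once `s` contains `range N`, the remainder of `x` is orthogonal to `e m` for `m < N`, so `T`
  -- acts on it as `A N`, of norm `l N`; its length is at most `2‖x‖`. The `+ 1` covers `x = 0`.
  obtain ⟨N, hN⟩ := hlim (ε / (2 * ‖x‖ + 1)) (by positivity)
  refine ⟨Finset.range N, fun s hs => ?_⟩
  have h1 : T x - ∑ n ∈ s, ((l n : ℂ) * ⟪e n, x⟫) • σ n = T (x - ∑ n ∈ s, ⟪e n, x⟫ • e n) := by
    simp only [map_sub, map_sum, map_smul, hTe, smul_smul, mul_comm]
  rw [dist_comm, dist_eq_norm, h1, hTA N]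
  · have h2 : ‖∑ n ∈ s, ⟪e n, x⟫ • e n‖ ≤ ‖x‖ :=
      (sq_le_sq₀ (norm_nonneg _) (norm_nonneg _)).1
        ((heB.norm_sum_sq_le s fun n => ⟪e n, x⟫).trans (isBessel_iff.1 heB x s))
    calc _ ≤ l N * ‖x - ∑ n ∈ s, ⟪e n, x⟫ • e n‖ := ContinuousLinearMap.le_opNorm _ _
      _ ≤ l N * (2 * ‖x‖) := by
          refine mul_le_mul_of_nonneg_left ((norm_sub_le _ _).trans (by linarith)) (norm_nonneg _)
      _ ≤ (ε / (2 * ‖x‖ + 1)) * (2 * ‖x‖) := by gcongr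
      _ < ε := by
          rw [div_mul_eq_mul_div, div_lt_iff₀ (by positivity)]
          nlinarith
  · intro m hm
    rw [inner_sub_right, inner_sum, Finset.sum_eq_single_of_mem m (hs (Finset.mem_range.2 hm))]
    · rw [inner_smul_right, hee]
      by_cases h : l m = 0
      · simp [(hl0 m h).1]
      · simp [h]
    · intro k _ hk
      rw [inner_smul_right, hel]
      simp [hk.symm]

end SVD

end QuatSchatten

/-! ### Trace, Hölder's inequality and Schatten duality on a complex Hilbert space. -/

namespace QuatSchatten

open MeasureTheory Filter Topology InnerProductSpace

section Trace

variable {K : Type*} [NormedAddCommGroup K] [InnerProductSpace ℂ K] [CompleteSpace K]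

local notation "⟪" x ", " y "⟫" => inner ℂ x y

omit [CompleteSpace K] in
theorem tsum_enorm_inner_sq_le {ι : Type*} {b : ι → K} (hb : Orthonormal ℂ b) (x : K) :
    ∑' k, ‖⟪b k, x⟫‖ₑ ^ 2 ≤ ‖x‖ₑ ^ 2 := by
  rw [ENNReal.tsum_eq_iSup_sum]
  refine iSup_le fun s => ?_
  rw [sum_enorm_sq, ← ofReal_norm, ← ENNReal.ofReal_pow (norm_nonneg _)]
  exact ENNReal.ofReal_le_ofReal (hb.sum_inner_products_le x)

omit [CompleteSpace K] in
theorem tsum_enorm_inner_mul_inner_le {ι : Type*} {b : ι → K} (hb : Orthonormal ℂ b) {x y : K}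
    (hx : ‖x‖ₑ ≤ 1) (hy : ‖y‖ₑ ≤ 1) : ∑' k, ‖⟪x, b k⟫‖ₑ * ‖⟪b k, y⟫‖ₑ ≤ 1 := by
  calc ∑' k, ‖⟪x, b k⟫‖ₑ * ‖⟪b k, y⟫‖ₑ
      ≤ ∑' k, 2⁻¹ * (‖⟪b k, x⟫‖ₑ ^ 2 + ‖⟪b k, y⟫‖ₑ ^ 2) := by
        refine ENNReal.tsum_le_tsum fun k => ?_
        rw [← ofReal_norm ⟪x, b k⟫, norm_inner_symm, ofReal_norm]
        exact ennreal_mul_le_half_sq_add_sq _ _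
    _ = 2⁻¹ * (∑' k, ‖⟪b k, x⟫‖ₑ ^ 2 + ∑' k, ‖⟪b k, y⟫‖ₑ ^ 2) := by
        rw [ENNReal.tsum_mul_left, ENNReal.tsum_add]
    _ ≤ 2⁻¹ * (1 + 1) := by
        gcongr
        · exact (tsum_enorm_inner_sq_le hb x).trans (pow_le_one₀ zero_le hx)
        · exact (tsum_enorm_inner_sq_le hb y).trans (pow_le_one₀ zero_le hy)
    _ = 1 := by rw [one_add_one_eq_two]; exact ENNReal.inv_mul_cancel (by simp) (by simp)

-- Fubini for `lₙ ⟪eₙ, bᵢ⟫ ⟪bᵢ, σₙ⟫`: summing absolute values over `i` first leaves at most `lₙ`,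
-- which is summable. Summing over `n` first gives the diagonal entries, summing over `i` first
-- gives `lₙ ⟪eₙ, σₙ⟫` by Parseval, an expression free of the basis.
omit [CompleteSpace K] in
theorem IsSVD.hasSum_trace {A : K →L[ℂ] K} {l : ℕ → ℝ} {e σ : ℕ → K} (h : IsSVD A l e σ)
    (hA : varNorm 1 A ≠ ∞) {ι : Type*} (b : HilbertBasis ι ℂ K) :
    HasSum (fun i => ⟪b i, A (b i)⟫) (∑' n, (l n : ℂ) * ⟪e n, σ n⟫) := by
  let F : ι × ℕ → ℂ := fun x => l x.2 * ⟪e x.2, b x.1⟫ * ⟪b x.1, σ x.2⟫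
  have hF : Summable F := by
    refine Summable.of_enorm (ne_top_of_le_ne_top hA ?_)
    rw [h.varNorm_eq le_rfl ENNReal.one_ne_top, seqNorm_one, ENNReal.tsum_prod', ENNReal.tsum_comm]
    refine ENNReal.tsum_le_tsum fun n => ?_
    simp only [F, enorm_mul, mul_assoc]
    rw [ENNReal.tsum_mul_left]
    exact mul_le_of_le_one_right zero_le (tsum_enorm_inner_mul_inner_le b.orthonormal
      (h.isBessel_left.enorm_le_one n) (h.isBessel_right.enorm_le_one n))
  obtain ⟨a, ha⟩ := hF
  have h1 : HasSum (fun i => ⟪b i, A (b i)⟫) a :=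
    ha.prod_fiberwise fun i => h.expansion.hasSum_inner (b i) (b i)
  have ha' : HasSum (fun x : ℕ × ι => F (x.2, x.1)) a :=
    (Equiv.prodComm ℕ ι).hasSum_iff.2 ha
  have h2 : HasSum (fun n => (l n : ℂ) * ⟪e n, σ n⟫) a :=
    ha'.prod_fiberwise fun n => by
      simp only [F, mul_assoc]
      exact (b.hasSum_inner_mul_inner (e n) (σ n)).mul_left _
  rwa [h2.tsum_eq]

/-- The trace of an operator on a complex Hilbert space. -/
noncomputable def opTrace (A : K →L[ℂ] K) : ℂ :=
  ∑' i, ⟪(exists_hilbertBasis ℂ K).choose_spec.choose i,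
    A ((exists_hilbertBasis ℂ K).choose_spec.choose i)⟫

theorem IsSVD.opTrace_eq {A : K →L[ℂ] K} {l : ℕ → ℝ} {e σ : ℕ → K} (h : IsSVD A l e σ)
    (hA : varNorm 1 A ≠ ∞) : opTrace A = ∑' n, (l n : ℂ) * ⟪e n, σ n⟫ :=
  (h.hasSum_trace hA _).tsum_eq

/-- The trace is given by every orthonormal basis. -/
theorem hasSum_opTrace {A : K →L[ℂ] K} (hA : varNorm 1 A ≠ ∞) {ι : Type*}
    (b : HilbertBasis ι ℂ K) : HasSum (fun i => ⟪b i, A (b i)⟫) (opTrace A) := by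
  obtain ⟨l, e, σ, h⟩ :=
    exists_isSVD (isCompactOperator_of_varNorm_ne_top one_ne_zero ENNReal.one_ne_top hA)
  rw [h.opTrace_eq hA]
  exact h.hasSum_trace hA b

theorem enorm_opTrace_le {A : K →L[ℂ] K} (hA : varNorm 1 A ≠ ∞) :
    ‖opTrace A‖ₑ ≤ varNorm 1 A := by
  obtain ⟨l, e, σ, h⟩ :=
    exists_isSVD (isCompactOperator_of_varNorm_ne_top one_ne_zero ENNReal.one_ne_top hA)
  rw [h.opTrace_eq hA, h.varNorm_eq le_rfl ENNReal.one_ne_top, seqNorm_one]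
  refine enorm_tsum_le_tsum_enorm.trans (ENNReal.tsum_le_tsum fun n => ?_)
  rw [enorm_mul]
  refine mul_le_of_le_one_right zero_le ?_
  rw [← ofReal_norm]
  refine ENNReal.ofReal_le_one.2 ((norm_inner_le_norm _ _).trans ?_)
  exact mul_le_one₀ (h.isBessel_left.norm_le_one n) (norm_nonneg _) (h.isBessel_right.norm_le_one n)

theorem opTrace_add {A B : K →L[ℂ] K} (hA : varNorm 1 A ≠ ∞) (hB : varNorm 1 B ≠ ∞) :
    opTrace (A + B) = opTrace A + opTrace B := by
  have hAB : varNorm 1 (A + B) ≠ ∞ :=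
    ne_top_of_le_ne_top (ENNReal.add_ne_top.2 ⟨hA, hB⟩) (varNorm_add_le le_rfl A B)
  obtain ⟨w, b, -⟩ := exists_hilbertBasis ℂ K
  refine (hasSum_opTrace hAB b).unique ?_
  simpa only [add_apply, inner_add_right] using (hasSum_opTrace hA b).add (hasSum_opTrace hB b)

theorem opTrace_smul (c : ℂ) {A : K →L[ℂ] K} (hA : varNorm 1 A ≠ ∞) :
    opTrace (c • A) = c * opTrace A := by
  have hcA : varNorm 1 (c • A) ≠ ∞ := by
    rw [varNorm_smul]; exact ENNReal.mul_ne_top enorm_ne_top hA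
  obtain ⟨w, b, -⟩ := exists_hilbertBasis ℂ K
  refine (hasSum_opTrace hcA b).unique ?_
  simpa [inner_smul_right] using (hasSum_opTrace hA b).mul_left c

/-- Hölder's inequality for Schatten norms. -/
theorem varNorm_mul_le {p q : ℝ≥0∞} (hpq : p.HolderConjugate q) (hp : p ≠ ∞) {T S : K →L[ℂ] K}
    (hT : IsCompactOperator T) : varNorm 1 (T * S) ≤ varNorm p T * varNorm q S := by
  obtain ⟨l, e, σ, h⟩ := exists_isSVD hT
  refine varNorm_le_iff.2 fun u v hu hv => ?_
  rw [seqNorm_one, ENNReal.tsum_eq_iSup_sum]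
  refine iSup_le fun s => ?_
  let z : ℕ → ℂ := fun n => ⟪v n, (T * S) (u n)⟫
  -- Phases turning each `z n` into its modulus, with value `0` where `z n = 0`.
  let c : ℕ → ℂ := fun n => (starRingEnd ℂ) (z n) / ‖z n‖
  have hc : ∀ n, ‖c n‖ ≤ 1 := fun n => by
    simp only [c, norm_div, RCLike.norm_conj, Complex.norm_real, norm_norm]
    exact div_self_le_one _
  have hcz : ∀ n, c n * z n = ‖z n‖ := fun n => by
    rcases eq_or_ne (z n) 0 with h0 | h0
    · simp [h0]
    · have : (‖z n‖ : ℂ) ≠ 0 := by exact_mod_cast norm_ne_zero_iff.2 h0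
      simp only [c]
      rw [div_mul_eq_mul_div, Complex.conj_mul', sq, mul_div_assoc, div_self this, mul_one]
  -- Chosen so that `∑ ‖z n‖ = ∑ₖ lₖ ⟪eₖ, S wₖ⟫`. Hölder for sequences then applies, with `(w, e)`
  -- as test pair for `S`; only `T` is decomposed, so `S` need not be compact.
  let w : ℕ → K := fun k => ∑ n ∈ s, (c n * ⟪v n, σ k⟫) • u n
  have hw : IsBessel w := by
    refine isBessel_iff.2 fun x t => ?_
    -- Moving the sum to the other side writes `⟪w k, x⟫` as an inner product of `σ k` with a
    -- combination of the `v n`; the Bessel property of `w` then comes from those of `σ`, `v` and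
    -- `u` in turn.
    have h1 : ∀ k, ⟪w k, x⟫ =
        ⟪σ k, ∑ n ∈ s, ((starRingEnd ℂ) (c n) * ⟪u n, x⟫) • v n⟫ := fun k => by
      simp only [w, sum_inner, inner_sum]
      refine Finset.sum_congr rfl fun n _ => ?_
      rw [inner_smul_left, inner_smul_right, map_mul, inner_conj_symm]
      ring
    simp only [h1]
    refine (isBessel_iff.1 h.isBessel_right _ t).trans ((hv.norm_sum_sq_le s _).trans ?_)
    refine le_trans (Finset.sum_le_sum fun n _ => ?_) (isBessel_iff.1 hu x s)
    rw [norm_mul, RCLike.norm_conj]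
    gcongr
    exact mul_le_of_le_one_left (norm_nonneg _) (hc n)
  have h2 : HasSum (fun k => (l k : ℂ) * ⟪e k, S (w k)⟫) ((∑ n ∈ s, ‖z n‖ : ℝ) : ℂ) := by
    have h3 : HasSum (fun k => ∑ n ∈ s, c n * ((l k : ℂ) * ⟪e k, S (u n)⟫ * ⟪v n, σ k⟫))
        (∑ n ∈ s, c n * z n) :=
      hasSum_sum fun n _ => (h.expansion.hasSum_inner (S (u n)) (v n)).mul_left (c n)
    simp only [hcz] at h3
    push_cast
    convert! h3 using 2 with k
    simp only [w, map_sum, inner_sum, map_smul, inner_smul_right, Finset.mul_sum]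
    exact Finset.sum_congr rfl fun n _ => by ring
  calc ∑ n ∈ s, ‖z n‖ₑ = ‖((∑ n ∈ s, ‖z n‖ : ℝ) : ℂ)‖ₑ := by
        rw [← ofReal_norm, Complex.norm_real, Real.norm_of_nonneg (by positivity),
          ENNReal.ofReal_sum_of_nonneg (fun _ _ => norm_nonneg _)]
        exact Finset.sum_congr rfl fun n _ => (ofReal_norm _).symm
    _ ≤ ∑' k, ‖(l k : ℂ) * ⟪e k, S (w k)⟫‖ₑ := by
        rw [← h2.tsum_eq]; exact enorm_tsum_le_tsum_enorm
    _ ≤ seqNorm p (fun k => (l k : ℂ)) * seqNorm q (fun k => ⟪e k, S (w k)⟫) :=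
        tsum_enorm_mul_le hpq _ _
    _ ≤ varNorm p T * varNorm q S := by
        rw [h.varNorm_eq (hpq.one_le p q) hp]
        gcongr
        exact seqNorm_le_varNorm q S hw h.isBessel_left

theorem varNorm_mul_ne_top {p q : ℝ≥0∞} (hpq : p.HolderConjugate q) (hp : p ≠ ∞)
    {T S : K →L[ℂ] K} (hT : varNorm p T ≠ ∞) (hS : varNorm q S ≠ ∞) : varNorm 1 (T * S) ≠ ∞ :=
  ne_top_of_le_ne_top (ENNReal.mul_ne_top hT hS) (varNorm_mul_le hpq hp
    (isCompactOperator_of_varNorm_ne_top (zero_lt_one.trans_le (hpq.one_le p q)).ne' hp hT))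

theorem enorm_opTrace_mul_le {p q : ℝ≥0∞} (hpq : p.HolderConjugate q) (hp : p ≠ ∞)
    {T S : K →L[ℂ] K} (hT : varNorm p T ≠ ∞) (hS : varNorm q S ≠ ∞) :
    ‖opTrace (T * S)‖ₑ ≤ varNorm p T * varNorm q S :=
  (enorm_opTrace_le (varNorm_mul_ne_top hpq hp hT hS)).trans (varNorm_mul_le hpq hp
    (isCompactOperator_of_varNorm_ne_top (zero_lt_one.trans_le (hpq.one_le p q)).ne' hp hT))

-- These sums are the test operators for duality: their coefficients are free, and pairing with them
-- probes the sequence `⟪g k, S (f k)⟫`.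
omit [CompleteSpace K] in
theorem varNorm_sum_rankOne_le {p : ℝ≥0∞} (hp : 1 ≤ p) (hp' : p ≠ ∞) {f g : ℕ → K}
    (hf : IsBessel f) (hg : IsBessel g) (s : Finset ℕ) {c : ℕ → ℂ} (hc : ∀ k, k ∉ s → c k = 0) :
    varNorm p (∑ k ∈ s, c k • rankOne ℂ (f k) (g k)) ≤ seqNorm p c := by
  refine IsExpansion.varNorm_le (e := g) (σ := f) (fun x => ?_) hg hf hp hp'
  have : (∑ k ∈ s, c k • rankOne ℂ (f k) (g k)) x = ∑ k ∈ s, (c k * ⟪g k, x⟫) • f k := by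
    simp [mul_smul]
  rw [this]
  exact hasSum_sum_of_ne_finset_zero fun k hk => by simp [hc k hk]

omit [CompleteSpace K] in
theorem varNorm_rankOne_le {p : ℝ≥0∞} (hp : 1 ≤ p) (hp' : p ≠ ∞) (f g : K) :
    varNorm p (rankOne ℂ f g) ≤ ‖f‖ₑ * ‖g‖ₑ := by
  have hp0 : p ≠ 0 := (zero_lt_one.trans_le hp).ne'
  have unit : ∀ x : K, ‖((‖x‖⁻¹ : ℝ) : ℂ) • x‖ ≤ 1 := fun x => by
    rw [norm_smul, Complex.norm_real, norm_inv, norm_norm, inv_mul_eq_div]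
    exact div_self_le_one _
  have hx : ∀ x : K, x = (‖x‖ : ℂ) • ((‖x‖⁻¹ : ℝ) : ℂ) • x := fun x => by
    rcases eq_or_ne x 0 with rfl | h0
    · simp
    · rw [smul_smul, ← Complex.ofReal_mul, mul_inv_cancel₀ (norm_ne_zero_iff.2 h0)]
      simp
  have h1 : rankOne ℂ f g = ((‖f‖ : ℂ) * ‖g‖) •
      rankOne ℂ (((‖f‖⁻¹ : ℝ) : ℂ) • f) (((‖g‖⁻¹ : ℝ) : ℂ) • g) := by
    conv_lhs => rw [hx f, hx g]
    simp only [map_smul, map_smulₛₗ, smul_apply, smul_smul]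
    congr 1
    simp only [map_mul, Complex.conj_ofReal]
    ring
  have h2 := varNorm_sum_rankOne_le hp hp' (isBessel_single (unit f)) (isBessel_single (unit g)) {0}
    (c := Pi.single 0 1) (fun k hk => by simp only [Finset.mem_singleton] at hk; simp [hk])
  have h3 : seqNorm p (Pi.single 0 (1 : ℂ) : ℕ → ℂ) = 1 := by
    rw [seqNorm_eq hp0 hp', tsum_eq_single 0]
    · simp
    · intro k hk
      simp [hk, ENNReal.toReal_pos hp0 hp']
  rw [h3] at h2
  rw [h1, varNorm_smul, enorm_mul]
  have h4 : ∀ x : K, ‖(‖x‖ : ℂ)‖ₑ = ‖x‖ₑ := fun x => by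
    rw [← ofReal_norm, Complex.norm_real, norm_norm, ofReal_norm]
  rw [h4, h4]
  refine mul_le_of_le_one_right zero_le ?_
  simpa using h2

/-- Parseval for the basis in the definition of the trace, applied to `S* g` and `f`. -/
theorem opTrace_rankOne_mul (f g : K) (S : K →L[ℂ] K) :
    opTrace (rankOne ℂ f g * S) = ⟪g, S f⟫ := by
  set b := (exists_hilbertBasis ℂ K).choose_spec.choose with hb
  have h := b.hasSum_inner_mul_inner (ContinuousLinearMap.adjoint S g) f
  rw [ContinuousLinearMap.adjoint_inner_left] at h
  rw [← h.tsum_eq, opTrace]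
  refine tsum_congr fun i => ?_
  rw [ContinuousLinearMap.adjoint_inner_left, ← hb]
  simp

omit [CompleteSpace K] in
/-- The dual description of the Schatten norm by finite rank operators. -/
theorem varNorm_le_of_forall_sum_le {p q : ℝ≥0∞} (hpq : p.HolderConjugate q) (hp : p ≠ ∞)
    {S : K →L[ℂ] K} {C : ℝ≥0∞}
    (h : ∀ (s : Finset ℕ) (c : ℕ → ℂ) (f g : ℕ → K), ‖∑ k ∈ s, c k * ⟪g k, S (f k)⟫‖ₑ ≤
      C * varNorm p (∑ k ∈ s, c k • rankOne ℂ (f k) (g k))) : varNorm q S ≤ C := by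
  refine varNorm_le_iff.2 fun f g hf hg => seqNorm_le_of_forall_sum_mul_le hpq hp fun s c hc => ?_
  refine (h s c f g).trans ?_
  gcongr
  exact varNorm_sum_rankOne_le (hpq.one_le p q) hp hf hg s hc

omit [CompleteSpace K] in
/-- Finite rank truncations of the singular value decomposition converge in the Schatten norm. -/
theorem IsSVD.tendsto_varNorm {T : K →L[ℂ] K} {l : ℕ → ℝ} {e σ : ℕ → K} (h : IsSVD T l e σ)
    {p : ℝ≥0∞} (hp : 1 ≤ p) (hp' : p ≠ ∞) (hT : varNorm p T ≠ ∞) :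
    Tendsto (fun s : Finset ℕ => varNorm p (T - ∑ k ∈ s, (l k : ℂ) • rankOne ℂ (σ k) (e k)))
      atTop (𝓝 0) := by
  classical
  have hp0 : p ≠ 0 := (zero_lt_one.trans_le hp).ne'
  have hP := ENNReal.toReal_pos hp0 hp'
  have hfin : ∑' n, ‖(l n : ℂ)‖ₑ ^ p.toReal ≠ ∞ := by
    rw [← seqNorm_rpow hp0 hp', ← h.varNorm_eq hp hp']
    exact ENNReal.rpow_ne_top_of_nonneg hP.le hT
  have hlim := (ENNReal.tendsto_tsum_compl_atTop_zero hfin).ennrpow_const (1 / p.toReal)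
  rw [ENNReal.zero_rpow_of_pos (by positivity)] at hlim
  refine tendsto_of_tendsto_of_tendsto_of_le_of_le tendsto_const_nhds hlim (fun _ => zero_le)
    fun s => ?_
  -- The remainder is an expansion along the same vectors with the coefficients in `s` set to `0`,
  -- so its norm is controlled by the tail of a convergent series.
  have h1 : IsExpansion (T - ∑ k ∈ s, (l k : ℂ) • rankOne ℂ (σ k) (e k))
      (fun n => if n ∈ s then 0 else (l n : ℂ)) e σ := fun x => by
    have h2 := (h.expansion x).sub (hasSum_sum_of_ne_finset_zero (s := s)
      (f := fun n => if n ∈ s then ((l n : ℂ) * ⟪e n, x⟫) • σ n else 0)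
      (fun n hn => by simp [hn]))
    convert! h2 using 1
    · ext n
      by_cases hn : n ∈ s <;> simp [hn]
    · rw [Finset.sum_congr rfl fun n hn => if_pos hn]
      simp [mul_smul]
  refine (h1.varNorm_le h.isBessel_left h.isBessel_right hp hp').trans (le_of_eq ?_)
  rw [seqNorm_eq hp0 hp']
  congr 1
  refine Eq.trans (tsum_congr fun n => ?_)
    (tsum_subtype {x | x ∉ s} fun n => ‖(l n : ℂ)‖ₑ ^ p.toReal).symm
  by_cases hn : n ∈ s <;> simp [hn, hP]

/-- The operators of finite Schatten norm. -/
def schattenSubmodule (K : Type*) [NormedAddCommGroup K] [InnerProductSpace ℂ K] {p : ℝ≥0∞}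
    (hp : 1 ≤ p) : Submodule ℂ (K →L[ℂ] K) where
  carrier := {T | varNorm p T ≠ ∞}
  add_mem' {T S} hT hS :=
    ne_top_of_le_ne_top (ENNReal.add_ne_top.2 ⟨hT, hS⟩) (varNorm_add_le hp T S)
  zero_mem' := by
    change varNorm p (0 : K →L[ℂ] K) ≠ ∞
    rw [varNorm_zero]; exact ENNReal.zero_ne_top
  smul_mem' c T hT := by
    change varNorm p (c • T) ≠ ∞
    rw [varNorm_smul]; exact ENNReal.mul_ne_top enorm_ne_top hT

omit [CompleteSpace K] in
theorem rankOne_mem_schattenSubmodule {p : ℝ≥0∞} (hp : 1 ≤ p) (hp' : p ≠ ∞) (f g : K) :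
    rankOne ℂ f g ∈ schattenSubmodule K hp :=
  ne_top_of_le_ne_top (ENNReal.mul_ne_top enorm_ne_top enorm_ne_top) (varNorm_rankOne_le hp hp' f g)

/-- The pairing is isometric in the second variable. -/
theorem varNorm_le_of_forall_opTrace_le {p q : ℝ≥0∞} (hpq : p.HolderConjugate q) (hp : p ≠ ∞)
    {S : K →L[ℂ] K} (hS : varNorm q S ≠ ∞) {C : ℝ≥0∞}
    (h : ∀ T, varNorm p T ≠ ∞ → ‖opTrace (T * S)‖ₑ ≤ C * varNorm p T) : varNorm q S ≤ C := by
  have hp1 : 1 ≤ p := hpq.one_le p q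
  refine varNorm_le_of_forall_sum_le hpq hp fun s c f g => ?_
  have hr : ∀ k, varNorm p (rankOne ℂ (f k) (g k)) ≠ ∞ := fun k =>
    rankOne_mem_schattenSubmodule hp1 hp _ _
  have h1 : ∀ s : Finset ℕ, varNorm p (∑ k ∈ s, c k • rankOne ℂ (f k) (g k)) ≠ ∞ := fun s =>
    (schattenSubmodule K hp1).sum_mem fun k _ => (schattenSubmodule K hp1).smul_mem _ (hr k)
  have h2 : opTrace ((∑ k ∈ s, c k • rankOne ℂ (f k) (g k)) * S) =
      ∑ k ∈ s, c k * ⟪g k, S (f k)⟫ := by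
    classical
    induction s using Finset.induction_on with
    | empty => simp [opTrace]
    | insert k s hk ih =>
      have h3 := varNorm_mul_ne_top hpq hp (hr k) hS
      rw [Finset.sum_insert hk, Finset.sum_insert hk, add_mul, opTrace_add, ih, smul_mul_assoc,
        opTrace_smul _ h3, opTrace_rankOne_mul]
      · rw [smul_mul_assoc, varNorm_smul]; exact ENNReal.mul_ne_top enorm_ne_top h3
      · exact varNorm_mul_ne_top hpq hp (h1 s) hS
  rw [← h2]
  exact h _ (h1 s)

/-- Every bounded functional on the Schatten class is represented by an operator. -/
theorem exists_opTrace_eq {p q : ℝ≥0∞} (hpq : p.HolderConjugate q) (hp : p ≠ ∞) (hp1 : 1 ≤ p)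
    (ξ : schattenSubmodule K hp1 →ₗ[ℂ] ℂ) {C : ℝ≥0∞} (hC : C ≠ ∞)
    (hξ : ∀ T, ‖ξ T‖ₑ ≤ C * varNorm p (T : K →L[ℂ] K)) :
    ∃ S : K →L[ℂ] K, varNorm q S ≤ C ∧ ∀ T, ξ T = opTrace ((T : K →L[ℂ] K) * S) := by
  let r : K → K → schattenSubmodule K hp1 := fun g f =>
    ⟨rankOne ℂ f g, rankOne_mem_schattenSubmodule hp1 hp f g⟩
  -- On rank one operators `ξ` is a sesquilinear form in `(g, f)`, bounded by `C`; the Riesz theorem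
  -- turns it into `S` with `⟪g, S f⟫ = ξ (r g f)`.
  let B : K →L⋆[ℂ] K →L[ℂ] ℂ := LinearMap.mkContinuous₂
    (LinearMap.mk₂'ₛₗ (starRingEnd ℂ) (RingHom.id ℂ) (fun g f => ξ (r g f))
      (fun g g' f => by
        rw [← map_add]; congr 1; ext1; simp [r])
      (fun c g f => by
        have : r (c • g) f = (starRingEnd ℂ c) • r g f := by ext1; simp [r]
        rw [this, map_smul])
      (fun g f f' => by
        rw [← map_add]; congr 1; ext1; simp [r])
      (fun c g f => by
        have : r g (c • f) = c • r g f := by ext1; simp [r]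
        rw [this, map_smul]; rfl))
    C.toReal (fun g f => by
      have h1 : ‖ξ (r g f)‖ₑ ≤ C * (‖f‖ₑ * ‖g‖ₑ) :=
        (hξ _).trans (by gcongr; exact varNorm_rankOne_le hp1 hp f g)
      have h2 := ENNReal.toReal_mono
        (ENNReal.mul_ne_top hC (ENNReal.mul_ne_top enorm_ne_top enorm_ne_top)) h1
      simp only [ENNReal.toReal_mul, toReal_enorm] at h2
      change ‖ξ (r g f)‖ ≤ _
      linarith)
  let S : K →L[ℂ] K := ContinuousLinearMap.adjoint (continuousLinearMapOfBilin B)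
  have hS : ∀ g f, ⟪g, S f⟫ = ξ (r g f) := fun g f => by
    rw [ContinuousLinearMap.adjoint_inner_right, continuousLinearMapOfBilin_apply]
    rfl
  have hsum : ∀ (s : Finset ℕ) (c : ℕ → ℂ) (f g : ℕ → K), ∑ k ∈ s, c k * ⟪g k, S (f k)⟫ =
      ξ (∑ k ∈ s, c k • r (g k) (f k)) := fun s c f g => by
    simp only [map_sum, map_smul, hS, smul_eq_mul]
  have hcoe : ∀ (s : Finset ℕ) (c : ℕ → ℂ) (f g : ℕ → K),
      ((∑ k ∈ s, c k • r (g k) (f k) : schattenSubmodule K hp1) : K →L[ℂ] K) =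
      ∑ k ∈ s, c k • rankOne ℂ (f k) (g k) := fun s c f g => by
    simp [r]
  have hSC : varNorm q S ≤ C := by
    refine varNorm_le_of_forall_sum_le hpq hp fun s c f g => ?_
    rw [hsum, ← hcoe]
    exact hξ _
  have hSt : varNorm q S ≠ ∞ := ne_top_of_le_ne_top hC hSC
  refine ⟨S, hSC, fun T => ?_⟩
  -- The defect of the representation. It is bounded, with constant `2 * C` since both terms have
  -- constant `C`, and vanishes on rank one operators, hence everywhere by the truncated
  -- decompositions.
  let η : schattenSubmodule K hp1 →ₗ[ℂ] ℂ :=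
    { toFun := fun T => ξ T - opTrace ((T : K →L[ℂ] K) * S)
      map_add' := fun T T' => by
        rw [map_add, Submodule.coe_add, add_mul, opTrace_add (varNorm_mul_ne_top hpq hp T.2 hSt)
          (varNorm_mul_ne_top hpq hp T'.2 hSt)]
        ring
      map_smul' := fun c T => by
        rw [map_smul, Submodule.coe_smul, smul_mul_assoc,
          opTrace_smul _ (varNorm_mul_ne_top hpq hp T.2 hSt), RingHom.id_apply, smul_eq_mul,
          smul_eq_mul]
        ring }
  have hη : ∀ T, ‖η T‖ₑ ≤ (2 * C) * varNorm p (T : K →L[ℂ] K) := fun T => by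
    refine (enorm_sub_le).trans ((add_le_add (hξ T) (enorm_opTrace_mul_le hpq hp T.2 hSt)).trans ?_)
    rw [two_mul, add_mul, mul_comm (varNorm p _)]
    gcongr
  have hηr : ∀ g f, η (r g f) = 0 := fun g f => by
    change ξ (r g f) - opTrace (rankOne ℂ f g * S) = 0
    rw [opTrace_rankOne_mul, hS, sub_self]
  obtain ⟨l, e, σ, h⟩ := exists_isSVD
    (isCompactOperator_of_varNorm_ne_top (zero_lt_one.trans_le hp1).ne' hp T.2)
  have hle : ∀ s : Finset ℕ, ‖η T‖ₑ ≤
      2 * C * varNorm p ((T : K →L[ℂ] K) - ∑ k ∈ s, (l k : ℂ) • rankOne ℂ (σ k) (e k)) := fun s => by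
    have h1 : η T = η (T - ∑ k ∈ s, (l k : ℂ) • r (e k) (σ k)) := by
      simp [map_sum, hηr]
    rw [h1]
    refine (hη _).trans (le_of_eq ?_)
    rw [AddSubgroupClass.coe_sub, hcoe s (fun k => (l k : ℂ)) σ e]
  have hlim := ENNReal.Tendsto.const_mul (a := 2 * C) (h.tendsto_varNorm hp1 hp T.2)
    (Or.inr (ENNReal.mul_ne_top (by simp) hC))
  rw [mul_zero] at hlim
  have h0 : ‖η T‖ₑ = 0 := le_antisymm (ge_of_tendsto' hlim hle) zero_le
  exact sub_eq_zero.1 (enorm_eq_zero.1 h0)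

end Trace

end QuatSchatten

/-! ### The plane `ℂ_i` inside the quaternions, and the quaternionic scalar product. -/

namespace QuatSchatten

open MeasureTheory Filter Topology

section Quaternions

theorem imaginaryUnits_sq (i : imaginaryUnits) :
    (i : ℍ[ℝ]).imI ^ 2 + (i : ℍ[ℝ]).imJ ^ 2 + (i : ℍ[ℝ]).imK ^ 2 = 1 := by
  have h := Quaternion.normSq_eq_norm_mul_self (i : ℍ[ℝ])
  rw [i.2.2, Quaternion.normSq_def', i.2.1] at h
  linarith

theorem imaginaryUnits_mul_self (i : imaginaryUnits) : (i : ℍ[ℝ]) * i = -1 := by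
  have h := imaginaryUnits_sq i
  have h0 : (i : ℍ[ℝ]).re = 0 := i.2.1
  ext <;> simp [h0] <;> linarith

theorem star_imaginaryUnits (i : imaginaryUnits) : star (i : ℍ[ℝ]) = -i := by
  have h0 : (i : ℍ[ℝ]).re = 0 := i.2.1
  ext <;> simp [h0]

/-- The embedding of `ℂ` onto `ℂ_i`. -/
noncomputable def iota (i : imaginaryUnits) : ℂ →ₐ[ℝ] ℍ[ℝ] :=
  Complex.lift ⟨i, imaginaryUnits_mul_self i⟩

theorem iota_apply (i : imaginaryUnits) (z : ℂ) : iota i z = planeScalar i z.re z.im := by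
  change (z.re : ℍ[ℝ]) + z.im • (i : ℍ[ℝ]) = _
  rw [planeScalar, Quaternion.mul_coe_eq_smul]

theorem iota_I (i : imaginaryUnits) : iota i Complex.I = i := by
  rw [iota_apply]
  simp [planeScalar]

theorem iota_ofReal (i : imaginaryUnits) (r : ℝ) : iota i (r : ℂ) = (r : ℍ[ℝ]) := by
  rw [iota_apply]
  simp [planeScalar]

theorem norm_iota (i : imaginaryUnits) (z : ℂ) : ‖iota i z‖ = ‖z‖ := by
  have h := imaginaryUnits_sq i
  have h0 : (i : ℍ[ℝ]).re = 0 := i.2.1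
  rw [← sq_eq_sq₀ (norm_nonneg _) (norm_nonneg _), sq, ← Quaternion.normSq_eq_norm_mul_self,
    Quaternion.normSq_def', ← Complex.normSq_eq_norm_sq, Complex.normSq_apply, iota_apply,
    planeScalar]
  simp [h0]
  linear_combination (z.im ^ 2) * h

theorem star_iota (i : imaginaryUnits) (z : ℂ) :
    star (iota i z) = iota i ((starRingEnd ℂ) z) := by
  have h0 : (i : ℍ[ℝ]).re = 0 := i.2.1
  rw [iota_apply, iota_apply]
  ext <;> simp [planeScalar, h0] <;> ring

theorem iota_comm (i : imaginaryUnits) (z w : ℂ) : iota i z * iota i w = iota i w * iota i z := by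
  rw [← map_mul, ← map_mul, mul_comm]

theorem iota_comm_unit (i : imaginaryUnits) (z : ℂ) : iota i z * i = i * iota i z := by
  rw [← iota_I, iota_comm]

/-- The coordinate of a quaternion in `ℂ_i`. -/
noncomputable def planeCoord (i : imaginaryUnits) (u : ℍ[ℝ]) : ℂ := ⟨u.re, -(u * i).re⟩

theorem planeCoord_add (i : imaginaryUnits) (u v : ℍ[ℝ]) :
    planeCoord i (u + v) = planeCoord i u + planeCoord i v := by
  apply Complex.ext
  · simp [planeCoord]
  · simp only [planeCoord, add_mul, Quaternion.re_add, Complex.add_im]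
    ring

/-- `planeCoord` is the orthogonal projection onto `ℂ_i`, hence left `ℂ_i`-linear. The inner product
axioms on `H₊^{Ji}` thus follow before it is known that scalar products there lie in `ℂ_i`. -/
theorem planeCoord_iota_mul (i : imaginaryUnits) (z : ℂ) (u : ℍ[ℝ]) :
    planeCoord i (iota i z * u) = z * planeCoord i u := by
  have h := imaginaryUnits_sq i
  have h0 : (i : ℍ[ℝ]).re = 0 := i.2.1
  rw [iota_apply]
  apply Complex.ext
  · simp [planeCoord, planeScalar, h0]
    ring
  · simp [planeCoord, planeScalar, h0]
    linear_combination (z.im * u.re) * h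

theorem planeCoord_star (i : imaginaryUnits) (u : ℍ[ℝ]) :
    planeCoord i (star u) = (starRingEnd ℂ) (planeCoord i u) := by
  have h0 : (i : ℍ[ℝ]).re = 0 := i.2.1
  apply Complex.ext
  · simp [planeCoord]
  · simp [planeCoord, h0]
    ring

theorem planeCoord_ofReal (i : imaginaryUnits) (r : ℝ) : planeCoord i (r : ℍ[ℝ]) = r := by
  have h0 : (i : ℍ[ℝ]).re = 0 := i.2.1
  apply Complex.ext <;> simp [planeCoord, h0]

theorem planeCoord_iota (i : imaginaryUnits) (z : ℂ) : planeCoord i (iota i z) = z := by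
  have := planeCoord_iota_mul i z ((1 : ℝ) : ℍ[ℝ])
  rw [planeCoord_ofReal] at this
  simpa using this

/-- The commutant of `i` is `ℂ_i`: commuting with `i` means that the imaginary part is parallel to
`i`. -/
theorem iota_planeCoord {i : imaginaryUnits} {u : ℍ[ℝ]} (h : u * i = i * u) :
    iota i (planeCoord i u) = u := by
  have h1 := imaginaryUnits_sq i
  have h0 : (i : ℍ[ℝ]).re = 0 := i.2.1
  have hI := congrArg QuaternionAlgebra.imI h
  have hJ := congrArg QuaternionAlgebra.imJ h
  have hK := congrArg QuaternionAlgebra.imK h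
  simp [h0] at hI hJ hK
  rw [iota_apply]
  ext
  · simp [planeCoord, planeScalar, h0]
  · simp [planeCoord, planeScalar, h0]
    linear_combination (u.imI) * h1 - (i : ℍ[ℝ]).imJ * hK / 2 + (i : ℍ[ℝ]).imK * hJ / 2
  · simp [planeCoord, planeScalar, h0]
    linear_combination (u.imJ) * h1 - (i : ℍ[ℝ]).imK * hI / 2 + (i : ℍ[ℝ]).imI * hK / 2
  · simp [planeCoord, planeScalar, h0]
    linear_combination (u.imK) * h1 - (i : ℍ[ℝ]).imI * hJ / 2 + (i : ℍ[ℝ]).imJ * hI / 2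

theorem mem_complexPlane_iff {i : imaginaryUnits} {u : ℍ[ℝ]} :
    u ∈ complexPlane i ↔ ∃ z, u = iota i z := by
  constructor
  · rintro ⟨a, b, rfl⟩
    exact ⟨⟨a, b⟩, by rw [iota_apply]⟩
  · rintro ⟨z, rfl⟩
    exact ⟨z.re, z.im, iota_apply i z⟩

/-- Imaginary units anticommute exactly when they are orthogonal in `ℝ³`. The first axis serves if
the first two coordinates of `i` vanish, otherwise those two coordinates are rotated by a right
angle and normalized. -/
theorem exists_anticommuting_unit (i : imaginaryUnits) :
    ∃ j : ℍ[ℝ], j * i = -(i * j) ∧ j * j = -1 ∧ ‖j‖ = 1 := by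
  have h := imaginaryUnits_sq i
  have h0 : (i : ℍ[ℝ]).re = 0 := i.2.1
  have key : ∃ x y z : ℝ, x ^ 2 + y ^ 2 + z ^ 2 = 1 ∧
      x * (i : ℍ[ℝ]).imI + y * (i : ℍ[ℝ]).imJ + z * (i : ℍ[ℝ]).imK = 0 := by
    by_cases hab : (i : ℍ[ℝ]).imI ^ 2 + (i : ℍ[ℝ]).imJ ^ 2 = 0
    · have : (i : ℍ[ℝ]).imI = 0 := by nlinarith [sq_nonneg (i : ℍ[ℝ]).imI, sq_nonneg (i : ℍ[ℝ]).imJ]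
      exact ⟨1, 0, 0, by norm_num, by simp [this]⟩
    · have hpos : 0 < (i : ℍ[ℝ]).imI ^ 2 + (i : ℍ[ℝ]).imJ ^ 2 :=
        lt_of_le_of_ne (by positivity) (Ne.symm hab)
      have hs := Real.sq_sqrt hpos.le
      have hs0 := Real.sqrt_pos.2 hpos
      refine ⟨-(i : ℍ[ℝ]).imJ / √((i : ℍ[ℝ]).imI ^ 2 + (i : ℍ[ℝ]).imJ ^ 2),
        (i : ℍ[ℝ]).imI / √((i : ℍ[ℝ]).imI ^ 2 + (i : ℍ[ℝ]).imJ ^ 2), 0, ?_, ?_⟩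
      · rw [div_pow, div_pow, hs]
        field_simp
        ring
      · field_simp
        ring
  obtain ⟨x, y, z, h1, h2⟩ := key
  obtain ⟨j, hr, rfl, rfl, rfl⟩ : ∃ j : ℍ[ℝ], j.re = 0 ∧ j.imI = x ∧ j.imJ = y ∧ j.imK = z :=
    ⟨⟨0, x, y, z⟩, rfl, rfl, rfl, rfl⟩
  refine ⟨j, ?_, ?_, ?_⟩
  · ext <;> simp [h0, hr] <;> linarith
  · ext <;> simp [hr] <;> linarith
  · rw [← sq_eq_sq₀ (norm_nonneg _) zero_le_one, sq, ← Quaternion.normSq_eq_norm_mul_self,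
      Quaternion.normSq_def', hr]
    linarith

/-- An imaginary unit anticommuting with `i`. -/
noncomputable def antiUnit (i : imaginaryUnits) : ℍ[ℝ] := (exists_anticommuting_unit i).choose

theorem antiUnit_mul (i : imaginaryUnits) : antiUnit i * i = -(i * antiUnit i) :=
  (exists_anticommuting_unit i).choose_spec.1

theorem antiUnit_mul_self (i : imaginaryUnits) : antiUnit i * antiUnit i = -1 :=
  (exists_anticommuting_unit i).choose_spec.2.1

theorem norm_antiUnit (i : imaginaryUnits) : ‖antiUnit i‖ = 1 :=
  (exists_anticommuting_unit i).choose_spec.2.2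

theorem iota_mul_antiUnit (i : imaginaryUnits) (z : ℂ) :
    iota i z * antiUnit i = antiUnit i * iota i ((starRingEnd ℂ) z) := by
  have h := antiUnit_mul i
  rw [iota_apply, iota_apply, planeScalar, planeScalar, add_mul, mul_add, Quaternion.coe_commutes,
    mul_assoc, Quaternion.coe_commutes, ← mul_assoc, ← mul_assoc (antiUnit i), h]
  simp

/-- Used for the orthogonality of `H₊^{Ji}` and `H₊^{Ji} j` with respect to the real part of the
scalar product. -/
theorem re_iota_mul_antiUnit (i : imaginaryUnits) (z : ℂ) : (iota i z * antiUnit i).re = 0 := by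
  have h0 : (i : ℍ[ℝ]).re = 0 := i.2.1
  have hjj := antiUnit_mul_self i
  have h := congrArg QuaternionAlgebra.re (antiUnit_mul i)
  have h3 : (antiUnit i).re = 0 := by
    have hI := congrArg QuaternionAlgebra.imI hjj
    have hJ := congrArg QuaternionAlgebra.imJ hjj
    have hK := congrArg QuaternionAlgebra.imK hjj
    have hR := congrArg QuaternionAlgebra.re hjj
    simp at hI hJ hK hR
    by_contra hne
    have e1 : (antiUnit i).imI = 0 := by
      refine (mul_eq_zero.1 (?_ : (antiUnit i).re * (antiUnit i).imI = 0)).resolve_left hne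
      linarith
    have e2 : (antiUnit i).imJ = 0 := by
      refine (mul_eq_zero.1 (?_ : (antiUnit i).re * (antiUnit i).imJ = 0)).resolve_left hne
      linarith
    have e3 : (antiUnit i).imK = 0 := by
      refine (mul_eq_zero.1 (?_ : (antiUnit i).re * (antiUnit i).imK = 0)).resolve_left hne
      linarith
    rw [e1, e2, e3] at hR
    nlinarith [sq_nonneg (antiUnit i).re]
  simp [h0, h3] at h
  rw [iota_apply, planeScalar]
  simp [h0, h3]
  linear_combination (z.im / 2) * h

/-- Split `a = b + c` into the part `b` commuting with `i` and the part `c` anticommuting with `i`.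
Then `c j` commutes with `i` too, and `c = -(c j) j`. -/
theorem exists_eq_iota_add (i : imaginaryUnits) (a : ℍ[ℝ]) :
    ∃ z w : ℂ, a = iota i z + iota i w * antiUnit i := by
  have hi := imaginaryUnits_mul_self i
  have hj := antiUnit_mul i
  have hjj := antiUnit_mul_self i
  set j := antiUnit i
  let b : ℍ[ℝ] := (1 / 2 : ℝ) • (a - i * a * i)
  let c : ℍ[ℝ] := (1 / 2 : ℝ) • (a + i * a * i)
  have hb : b * i = i * b := by
    simp only [b, smul_mul_assoc, mul_smul_comm, sub_mul, mul_sub]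
    rw [mul_assoc (i * a : ℍ[ℝ]), hi, mul_assoc (i : ℍ[ℝ]) a i, ← mul_assoc (i : ℍ[ℝ]) (i : ℍ[ℝ]),
      hi]
    congr 1
    noncomm_ring
  have hc : c * i = -(i * c) := by
    simp only [c, smul_mul_assoc, mul_smul_comm, add_mul, mul_add]
    rw [mul_assoc (i * a : ℍ[ℝ]), hi, mul_assoc (i : ℍ[ℝ]) a i, ← mul_assoc (i : ℍ[ℝ]) (i : ℍ[ℝ]),
      hi, ← smul_neg]
    congr 1
    noncomm_ring
  have hcj : c * j * i = i * (c * j) := by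
    rw [mul_assoc, hj, mul_neg, ← mul_assoc, hc, neg_mul, neg_neg, mul_assoc]
  refine ⟨planeCoord i b, -planeCoord i (c * j), ?_⟩
  rw [map_neg, iota_planeCoord hb, iota_planeCoord hcj, neg_mul, mul_assoc, hjj, mul_neg, mul_one,
    neg_neg, ← smul_add]
  have : a - i * a * i + (a + i * a * i) = (2 : ℝ) • a := by rw [two_smul]; abel
  rw [this, smul_smul]
  norm_num

end Quaternions

section InnerProduct

variable {H : Type*} [NormedAddCommGroup H] [Module ℍ[ℝ]ᵐᵒᵖ H] [QuaternionicInner H]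

theorem ip_add_right (x y z : H) : ip x (y + z) = ip x y + ip x z :=
  QuaternionicInner.inner_add_right' x y z

theorem ip_smul_right (x y : H) (a : ℍ[ℝ]) : ip x (op a • y) = ip x y * a :=
  QuaternionicInner.inner_smul_right' x y a

theorem star_ip (x y : H) : star (ip y x) = ip x y := QuaternionicInner.star_inner' x y

theorem ip_self (x : H) : ip x x = ((‖x‖ ^ 2 : ℝ) : ℍ[ℝ]) := QuaternionicInner.inner_self' x

theorem ip_add_left (x y z : H) : ip (x + y) z = ip x z + ip y z := by
  rw [← star_ip, ip_add_right, star_add, star_ip, star_ip]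

theorem ip_smul_left (x y : H) (a : ℍ[ℝ]) : ip (op a • x) y = star a * ip x y := by
  rw [← star_ip, ip_smul_right, star_mul, star_ip]

/-- The scalar product as an additive map in the second variable. -/
def ipHom (x : H) : H →+ ℍ[ℝ] := AddMonoidHom.mk' (ip x) (ip_add_right x)

theorem ipHom_apply (x y : H) : ipHom x y = ip x y := rfl

theorem ip_zero_right (x : H) : ip x (0 : H) = 0 := map_zero (ipHom x)

theorem ip_zero_left (x : H) : ip (0 : H) x = 0 := by rw [← star_ip, ip_zero_right, star_zero]

theorem ip_neg_right (x y : H) : ip x (-y) = -ip x y := map_neg (ipHom x) y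

theorem ip_neg_left (x y : H) : ip (-x) y = -ip x y := by
  rw [← star_ip, ip_neg_right, star_neg, star_ip]

theorem ip_sub_right (x y z : H) : ip x (y - z) = ip x y - ip x z := map_sub (ipHom x) y z

theorem ip_sum_right {ι : Type*} (x : H) (s : Finset ι) (f : ι → H) :
    ip x (∑ k ∈ s, f k) = ∑ k ∈ s, ip x (f k) := map_sum (ipHom x) f s

theorem coe_eq_zero_iff {r : ℝ} : (r : ℍ[ℝ]) = 0 ↔ r = 0 :=
  ⟨fun h => Quaternion.coe_injective (h.trans Quaternion.coe_zero.symm), fun h => by simp [h]⟩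

theorem coe_finset_sum {ι : Type*} (s : Finset ι) (f : ι → ℝ) :
    ((∑ k ∈ s, f k : ℝ) : ℍ[ℝ]) = ∑ k ∈ s, (f k : ℍ[ℝ]) :=
  map_sum (algebraMap ℝ ℍ[ℝ]) f s

theorem eq_of_forall_ip_eq {x y : H} (h : ∀ z, ip x z = ip y z) : x = y := by
  have h1 : ip (x - y) (x - y) = 0 := by
    have : ∀ z, ip (x - y) z = 0 := fun z => by
      rw [sub_eq_add_neg, ip_add_left, ip_neg_left, h z, add_neg_cancel]
    exact this _
  rw [ip_self, coe_eq_zero_iff, sq_eq_zero_iff, norm_eq_zero] at h1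
  exact sub_eq_zero.1 h1

theorem star_mul_self_eq_norm_sq (a : ℍ[ℝ]) : star a * a = ((‖a‖ ^ 2 : ℝ) : ℍ[ℝ]) := by
  rw [Quaternion.star_mul_self, Quaternion.normSq_eq_norm_mul_self, sq]

theorem norm_add_sq (x y : H) : ‖x + y‖ ^ 2 = ‖x‖ ^ 2 + 2 * (ip x y).re + ‖y‖ ^ 2 := by
  have h := congrArg QuaternionAlgebra.re (ip_self (x + y))
  have h1 : (ip y x).re = (ip x y).re := by rw [← star_ip, Quaternion.re_star]
  rw [ip_add_left, ip_add_right, ip_add_right, ip_self, ip_self] at h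
  simp only [Quaternion.re_add, Quaternion.re_coe, h1] at h
  linarith

/-- Bessel's inequality in a quaternionic Hilbert space. -/
theorem sum_norm_ip_sq_le {e : ℕ → H} {t : ℕ → Prop} [DecidablePred t]
    (he : ∀ m n, ip (e m) (e n) = if m = n ∧ t m then 1 else 0) (x : H) (s : Finset ℕ) :
    ∑ k ∈ s, ‖ip (e k) x‖ ^ 2 ≤ ‖x‖ ^ 2 := by
  set D := ∑ k ∈ s, ‖ip (e k) x‖ ^ 2 with hD
  set y := ∑ k ∈ s, op (ip (e k) x) • e k with hy
  have hzero : ∀ k, ¬ t k → e k = 0 := fun k hk => by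
    have h := he k k
    rw [if_neg (by tauto), ip_self, coe_eq_zero_iff, sq_eq_zero_iff, norm_eq_zero] at h
    exact h
  have h1 : ip x y = (D : ℍ[ℝ]) := by
    rw [hy, ip_sum_right, hD, coe_finset_sum]
    refine Finset.sum_congr rfl fun k _ => ?_
    rw [ip_smul_right, ← star_ip, star_mul_self_eq_norm_sq]
  have h2 : ∀ k ∈ s, ip (e k) y = ip (e k) x := fun k hk => by
    rw [hy, ip_sum_right, Finset.sum_eq_single_of_mem k hk]
    · rw [ip_smul_right, he]
      by_cases h : t k
      · simp [h]
      · simp [hzero k h, ip_zero_left]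
    · intro m _ hm
      rw [ip_smul_right, he, if_neg (fun h => hm h.1.symm), zero_mul]
  have h3 : ip y y = (D : ℍ[ℝ]) := by
    have h4 : ip y y = ip y (∑ k ∈ s, op (ip (e k) x) • e k) := by rw [← hy]
    rw [h4, ip_sum_right, hD, coe_finset_sum]
    refine Finset.sum_congr rfl fun k hk => ?_
    rw [ip_smul_right, ← star_ip, h2 k hk, star_mul_self_eq_norm_sq]
  -- `y` is the projection of `x` onto the span, with `⟨x, y⟩ = ⟨y, y⟩ = D`, so `0 ≤ ‖x - y‖² = ‖x‖²
  -- - D`.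
  have h5 := norm_add_sq x (-y)
  rw [ip_neg_right, h1, norm_neg] at h5
  have h6 : ‖y‖ ^ 2 = D := by
    have := h3
    rw [ip_self] at this
    exact Quaternion.coe_injective this
  rw [h6, Quaternion.re_neg, Quaternion.re_coe] at h5
  nlinarith [sq_nonneg ‖x + -y‖]

/-- Cauchy–Schwarz is Bessel's inequality for the single vector `x / ‖x‖`. -/
theorem norm_ip_le (x y : H) : ‖ip x y‖ ≤ ‖x‖ * ‖y‖ := by
  rcases eq_or_ne x 0 with rfl | hx
  · simp [ip_zero_left]
  have hx' : ‖x‖ ≠ 0 := norm_ne_zero_iff.2 hx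
  have h := sum_norm_ip_sq_le (e := fun k => if k = 0 then op ((‖x‖⁻¹ : ℝ) : ℍ[ℝ]) • x else 0)
    (t := fun k => k = 0) (fun m n => by
      by_cases hm : m = 0
      · by_cases hn : n = 0
        · simp only [hm, hn, if_true, ip_self, norm_op_smul]
          simp [hx']
        · simp [hm, hn, ip_zero_right, Ne.symm hn]
      · simp [hm, ip_zero_left]) y {0}
  simp only [Finset.sum_singleton, if_true, ip_smul_left, norm_mul, norm_star,
    Quaternion.norm_coe, norm_inv, norm_norm] at h
  have h1 := (sq_le_sq₀ (by positivity) (norm_nonneg _)).1 h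
  rwa [inv_mul_le_iff₀ (by positivity)] at h1

theorem continuous_ip (x : H) : Continuous fun y : H => ip x y :=
  AddMonoidHomClass.continuous_of_bound (ipHom x) ‖x‖ fun y => norm_ip_le x y

end InnerProduct

end QuatSchatten

/-! ### The complex Hilbert space `H₊^{Ji}` and the correspondence of operators. -/

namespace QuatSchatten

open MeasureTheory Filter Topology

section PlusSpace

variable {H : Type*} [NormedAddCommGroup H] [Module ℍ[ℝ]ᵐᵒᵖ H] [QuaternionicInner H]

/-- The additive group of `H₊^{Ji}`. -/
def plusGroup (J : Op H) (i : imaginaryUnits) : AddSubgroup H where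
  carrier := plusSpace J i
  add_mem' {x y} hx hy := by
    change J (x + y) = op (i : ℍ[ℝ]) • (x + y)
    rw [map_add, smul_add, show J x = _ from hx, show J y = _ from hy]
  zero_mem' := by
    change J 0 = op (i : ℍ[ℝ]) • (0 : H)
    simp
  neg_mem' {x} hx := by
    change J (-x) = op (i : ℍ[ℝ]) • (-x)
    rw [map_neg, smul_neg, show J x = _ from hx]

variable {J : Op H} {i : imaginaryUnits}

omit [QuaternionicInner H] in
theorem mem_plusGroup {x : H} : x ∈ plusGroup J i ↔ J x = op (i : ℍ[ℝ]) • x := Iff.rfl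

omit [QuaternionicInner H] in
theorem plusGroup.apply_eq (x : plusGroup J i) : J x = op (i : ℍ[ℝ]) • (x : H) := x.2

omit [QuaternionicInner H] in
theorem iota_smul_mem (z : ℂ) {x : H} (hx : x ∈ plusGroup J i) :
    op (iota i z) • x ∈ plusGroup J i := by
  rw [mem_plusGroup] at hx ⊢
  rw [map_smul, hx, smul_smul, smul_smul, ← op_mul, ← op_mul, iota_comm_unit]

noncomputable instance : SMul ℂ (plusGroup J i) :=
  ⟨fun z x => ⟨op (iota i z) • (x : H), iota_smul_mem z x.2⟩⟩

omit [QuaternionicInner H] in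
theorem plusGroup.coe_smul (z : ℂ) (x : plusGroup J i) :
    ((z • x : plusGroup J i) : H) = op (iota i z) • (x : H) := rfl

noncomputable instance : Module ℂ (plusGroup J i) where
  one_smul x := by ext; simp [plusGroup.coe_smul]
  mul_smul z w x := by
    ext; rw [plusGroup.coe_smul, plusGroup.coe_smul, plusGroup.coe_smul, smul_smul, ← op_mul,
      mul_comm z, map_mul]
  smul_zero z := by ext; simp [plusGroup.coe_smul]
  smul_add z x y := by ext; simp [plusGroup.coe_smul]
  add_smul z w x := by ext; simp [plusGroup.coe_smul, add_smul]
  zero_smul x := by ext; simp [plusGroup.coe_smul]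

noncomputable instance : NormedSpace ℂ (plusGroup J i) where
  norm_smul_le z x := by
    change ‖op (iota i z) • (x : H)‖ ≤ ‖z‖ * ‖(x : H)‖
    rw [norm_op_smul, norm_iota]

noncomputable instance : InnerProductSpace ℂ (plusGroup J i) where
  inner x y := planeCoord i (ip (x : H) (y : H))
  norm_sq_eq_re_inner x := by
    change ‖(x : H)‖ ^ 2 = (planeCoord i (ip (x : H) (x : H))).re
    rw [ip_self, planeCoord_ofReal, Complex.ofReal_re]
  conj_inner_symm x y := by
    change (starRingEnd ℂ) (planeCoord i (ip (y : H) (x : H))) = planeCoord i (ip (x : H) (y : H))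
    rw [← planeCoord_star, star_ip]
  add_left x y z := by
    change planeCoord i (ip ((x : H) + (y : H)) (z : H)) = _
    rw [ip_add_left, planeCoord_add]
  smul_left x y z := by
    change planeCoord i (ip (op (iota i z) • (x : H)) (y : H)) = _ * planeCoord i (ip (x : H) (y : H))
    rw [ip_smul_left, star_iota, planeCoord_iota_mul]

instance [CompleteSpace H] : CompleteSpace (plusGroup J i) := by
  have : IsClosed {x : H | J x = op (i : ℍ[ℝ]) • x} :=
    isClosed_eq J.continuous (continuous_op_smul _)
  exact this.completeSpace_coe

/-- An anti-selfadjoint operator with square `-1`. -/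
class IsImaginary (J : Op H) : Prop where
  anti : IsAntiSelfAdjoint J
  sq : ∀ x, J (J x) = -x

theorem isImaginary_of (hJ : IsAntiSelfAdjoint J) (hJ' : IsUnitary J) : IsImaginary J := by
  refine ⟨hJ, fun x => ?_⟩
  obtain ⟨S, hS, hSJ, -⟩ := hJ'
  have h1 : ∀ x, S x = (-J : Op H) x := fun x =>
    eq_of_forall_ip_eq fun z => by rw [hS x z, hJ x z]
  have h2 : S (J x) = x := congrArg (fun A : Op H => A x) hSJ
  rw [h1] at h2
  have h3 : -J (J x) = x := h2
  rw [← h3, neg_neg, h3]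

variable [IsImaginary J]

/-- Since `J* = -J`, both `⟨x, y⟩ i` and `i ⟨x, y⟩` equal `⟨x, J y⟩`, so the scalar product lies in
`ℂ_i`. -/
theorem iota_inner (x y : plusGroup J i) : iota i (inner ℂ x y) = ip (x : H) (y : H) := by
  refine iota_planeCoord ?_
  have h := IsImaginary.anti (J := J) (x : H) (y : H)
  rw [plusGroup.apply_eq, ip_smul_right] at h
  rw [← h]
  change ip (-(J (x : H))) (y : H) = _
  rw [plusGroup.apply_eq, ip_neg_left, ip_smul_left, star_imaginaryUnits, neg_mul, neg_neg]

theorem norm_inner_plus (x y : plusGroup J i) : ‖(inner ℂ x y : ℂ)‖ = ‖ip (x : H) (y : H)‖ := by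
  rw [← iota_inner, norm_iota]

/-- The projection of `H` onto `H₊^{Ji}`. -/
noncomputable def plusProj (J : Op H) [IsImaginary J] (i : imaginaryUnits) : H →+ plusGroup J i where
  toFun x := ⟨op ((1 / 2 : ℝ) : ℍ[ℝ]) • (x - op (i : ℍ[ℝ]) • J x), by
    have hi : op (i : ℍ[ℝ]) * op (i : ℍ[ℝ]) = -1 := by
      rw [← op_mul, imaginaryUnits_mul_self]; rfl
    have hc : op (i : ℍ[ℝ]) * op ((1 / 2 : ℝ) : ℍ[ℝ]) = op ((1 / 2 : ℝ) : ℍ[ℝ]) * op (i : ℍ[ℝ]) := by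
      rw [← op_mul, ← op_mul, Quaternion.coe_commutes]
    rw [mem_plusGroup, map_smul, map_sub, map_smul, IsImaginary.sq, smul_smul, hc, mul_smul,
      smul_sub (op (i : ℍ[ℝ])), smul_smul (op (i : ℍ[ℝ])) (op (i : ℍ[ℝ])), hi]
    congr 1
    simp only [smul_neg, neg_smul, one_smul, sub_neg_eq_add]
    abel⟩
  map_zero' := by ext; simp
  map_add' x y := by
    ext
    simp only [AddSubgroup.coe_add, map_add, smul_add, smul_sub]
    abel

theorem coe_plusProj (x : H) : (plusProj J i x : H) =
    op ((1 / 2 : ℝ) : ℍ[ℝ]) • (x - op (i : ℍ[ℝ]) • J x) := rfl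

theorem continuous_plusProj : Continuous (plusProj J i) := by
  refine Continuous.subtype_mk ?_ _
  exact (continuous_op_smul _).comp (continuous_id.sub ((continuous_op_smul _).comp J.continuous))

omit [QuaternionicInner H] in
theorem half_smul_add_self (x : H) : op ((1 / 2 : ℝ) : ℍ[ℝ]) • (x + x) = x := by
  rw [smul_add, ← add_smul, ← op_add, ← Quaternion.coe_add]
  norm_num

theorem plusProj_coe (x : plusGroup J i) : plusProj J i (x : H) = x := by
  ext
  rw [coe_plusProj, plusGroup.apply_eq, smul_smul, ← op_mul, imaginaryUnits_mul_self]
  simp only [op_neg, op_one, neg_smul, one_smul, sub_neg_eq_add]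
  exact half_smul_add_self _

theorem plusProj_iota_smul (z : ℂ) (x : H) :
    plusProj J i (op (iota i z) • x) = z • plusProj J i x := by
  ext
  rw [plusGroup.coe_smul, coe_plusProj, coe_plusProj, map_smul, smul_smul (op (i : ℍ[ℝ])),
    ← op_mul, iota_comm_unit, op_mul, mul_smul, ← smul_sub, smul_smul, smul_smul, ← op_mul,
    ← op_mul, Quaternion.coe_commutes]

theorem plusProj_apply_J (x : H) : plusProj J i (J x) = Complex.I • plusProj J i x := by
  rw [← plusProj_iota_smul, iota_I]
  ext
  rw [coe_plusProj, coe_plusProj, IsImaginary.sq, map_smul, smul_smul, ← op_mul,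
    imaginaryUnits_mul_self]
  congr 1
  simp only [smul_neg, op_neg, op_one, neg_smul, one_smul, sub_neg_eq_add]
  abel

theorem plusProj_antiUnit_smul (x : plusGroup J i) :
    plusProj J i (op (antiUnit i) • (x : H)) = 0 := by
  ext
  rw [coe_plusProj, map_smul, plusGroup.apply_eq, smul_smul, smul_smul, ← op_mul, ← op_mul]
  have : (i : ℍ[ℝ]) * antiUnit i * i = antiUnit i := by
    rw [mul_assoc, antiUnit_mul, mul_neg, ← mul_assoc, imaginaryUnits_mul_self]
    simp
  rw [← mul_assoc, this, sub_self, smul_zero]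
  rfl

omit [QuaternionicInner H] in
theorem op_antiUnit_sq_smul (x : H) : op (antiUnit i) • op (antiUnit i) • x = -x := by
  rw [smul_smul, ← op_mul, antiUnit_mul_self]
  simp

/-- The decomposition `H = H₊ ⊕ H₊ j`: as `j i j = i`, the part of `x` outside `H₊` is `-P(x j) j`,
with `P` the projection. -/
theorem eq_plusProj_sub (x : H) : x = (plusProj J i x : H) -
    op (antiUnit i) • (plusProj J i (op (antiUnit i) • x) : H) := by
  have hjij : antiUnit i * i * antiUnit i = i := by
    rw [antiUnit_mul, neg_mul, mul_assoc, antiUnit_mul_self]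
    simp
  have h1 : op (antiUnit i) • (plusProj J i (op (antiUnit i) • x) : H) =
      op ((1 / 2 : ℝ) : ℍ[ℝ]) • (-x - op (i : ℍ[ℝ]) • J x) := by
    rw [coe_plusProj, smul_smul, ← op_mul, Quaternion.coe_commutes, op_mul, mul_smul, smul_sub,
      op_antiUnit_sq_smul, map_smul, smul_smul, smul_smul, ← op_mul, ← op_mul, ← mul_assoc, hjij]
  rw [h1, coe_plusProj, ← smul_sub]
  have h2 : x - op (i : ℍ[ℝ]) • J x - (-x - op (i : ℍ[ℝ]) • J x) = x + x := by abel
  rw [h2, half_smul_add_self]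

/-- Pythagoras: `⟨x, y j⟩` lies in `ℂ_i j`, whose elements have real part zero. -/
theorem norm_sub_antiUnit_smul_sq (x y : plusGroup J i) :
    ‖(x : H) - op (antiUnit i) • (y : H)‖ ^ 2 = ‖x‖ ^ 2 + ‖y‖ ^ 2 := by
  rw [sub_eq_add_neg, norm_add_sq, ip_neg_right, ip_smul_right, ← iota_inner, norm_neg,
    norm_op_smul, norm_antiUnit, Quaternion.re_neg, re_iota_mul_antiUnit]
  simp

/-- The compression of an operator to `H₊^{Ji}`. -/
noncomputable def compress (J : Op H) [IsImaginary J] (i : imaginaryUnits) (T : Op H) :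
    plusGroup J i →L[ℂ] plusGroup J i where
  toFun x := plusProj J i (T x)
  map_add' x y := by simp
  map_smul' z x := by
    rw [plusGroup.coe_smul, map_smul, plusProj_iota_smul]; rfl
  cont := continuous_plusProj.comp (T.continuous.comp continuous_subtype_val)

theorem compress_apply (T : Op H) (x : plusGroup J i) : compress J i T x = plusProj J i (T x) := rfl

omit [QuaternionicInner H] [IsImaginary J] in
theorem apply_mem_plusGroup {T : Op H} (hT : T * J = J * T) (x : plusGroup J i) :
    T x ∈ plusGroup J i := by
  have h : T (J x) = J (T x) := congrArg (fun A : Op H => A (x : H)) hT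
  rw [mem_plusGroup, ← h, plusGroup.apply_eq, map_smul]

theorem coe_compress {T : Op H} (hT : T * J = J * T) (x : plusGroup J i) :
    (compress J i T x : H) = T x := by
  rw [compress_apply]
  exact congrArg Subtype.val (plusProj_coe (⟨T x, apply_mem_plusGroup hT x⟩ : plusGroup J i))

theorem apply_eq_compress {T : Op H} (hT : T * J = J * T) (x : H) :
    T x = (compress J i T (plusProj J i x) : H) -
      op (antiUnit i) • (compress J i T (plusProj J i (op (antiUnit i) • x)) : H) := by
  nth_rewrite 1 [eq_plusProj_sub (J := J) (i := i) x]
  rw [map_sub, map_smul, coe_compress hT, coe_compress hT]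

theorem compress_injective {T S : Op H} (hT : T * J = J * T) (hS : S * J = J * S)
    (h : compress J i T = compress J i S) : T = S := by
  ext x
  rw [apply_eq_compress (i := i) hT, apply_eq_compress (i := i) hS, h]

theorem compress_add (T S : Op H) : compress J i (T + S) = compress J i T + compress J i S := by
  ext1 x
  simp [compress_apply]

theorem compress_zero : compress J i 0 = 0 := by
  ext1 x
  simp [compress_apply]

theorem compress_mul (T : Op H) {S : Op H} (hS : S * J = J * S) :
    compress J i (T * S) = compress J i T * compress J i S := by
  ext1 x
  change plusProj J i (T (S x)) = plusProj J i (T (compress J i S x))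
  rw [coe_compress hS]

theorem compress_leftSMul (a₀ a₁ : ℝ) (T : Op H) :
    compress J i (leftSMul J a₀ a₁ T) = (⟨a₀, a₁⟩ : ℂ) • compress J i T := by
  ext1 x
  change plusProj J i (op (a₀ : ℍ[ℝ]) • T x + op (a₁ : ℍ[ℝ]) • J (T x)) =
    (⟨a₀, a₁⟩ : ℂ) • plusProj J i (T x)
  rw [map_add, ← iota_ofReal i a₀, ← iota_ofReal i a₁, plusProj_iota_smul, plusProj_iota_smul,
    plusProj_apply_J, smul_smul, ← add_smul]
  congr 1
  apply Complex.ext <;> simp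

omit [IsImaginary J] in
theorem leftSMul_commute {a₀ a₁ : ℝ} {T : Op H} (hT : T * J = J * T) :
    leftSMul J a₀ a₁ T * J = J * leftSMul J a₀ a₁ T := by
  ext x
  have h : ∀ x, T (J x) = J (T x) := fun x => congrArg (fun A : Op H => A x) hT
  change op (a₀ : ℍ[ℝ]) • T (J x) + op (a₁ : ℍ[ℝ]) • J (T (J x)) =
    J (op (a₀ : ℍ[ℝ]) • T x + op (a₁ : ℍ[ℝ]) • J (T x))
  simp only [map_add, map_smul, h]

/-- The right linear operator on `H` extending an operator on `H₊^{Ji}`. -/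
noncomputable def extend (A : plusGroup J i →L[ℂ] plusGroup J i) : Op H where
  toFun x := (A (plusProj J i x) : H) - op (antiUnit i) • (A (plusProj J i (op (antiUnit i) • x)) : H)
  map_add' x y := by
    simp only [map_add, smul_add, AddSubgroup.coe_add]
    abel
  map_smul' c x := by
    -- Every scalar is `z + w j` with `z`, `w` in `ℂ_i`, so right linearity needs checking only for
    -- scalars in `ℂ_i` (`e1`) and for `j` (`e2`). In `e1` the conjugation from passing `z` across
    -- `j` occurs twice and cancels.
    obtain ⟨z, w, hc⟩ := exists_eq_iota_add i (unop c)
    have hc' : c = op (iota i z) + op (antiUnit i) * op (iota i w) := by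
      rw [← op_mul, ← op_add, ← hc, op_unop]
    have hz : ∀ (z : ℂ) (y : H), op (antiUnit i) • op (iota i z) • y =
        op (iota i ((starRingEnd ℂ) z)) • op (antiUnit i) • y := fun z y => by
      rw [smul_smul, smul_smul, ← op_mul, ← op_mul, iota_mul_antiUnit]
    have e1 : ∀ (z : ℂ) (y : H), (A (plusProj J i (op (iota i z) • y)) : H) -
        op (antiUnit i) • (A (plusProj J i (op (antiUnit i) • op (iota i z) • y)) : H) =
        op (iota i z) • ((A (plusProj J i y) : H) -
          op (antiUnit i) • (A (plusProj J i (op (antiUnit i) • y)) : H)) := fun z y => by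
      rw [hz, plusProj_iota_smul, plusProj_iota_smul, map_smul, map_smul, plusGroup.coe_smul,
        plusGroup.coe_smul, hz, Complex.conj_conj, smul_sub]
    have e2 : ∀ y : H, (A (plusProj J i (op (antiUnit i) • y)) : H) -
        op (antiUnit i) • (A (plusProj J i (op (antiUnit i) • op (antiUnit i) • y)) : H) =
        op (antiUnit i) • ((A (plusProj J i y) : H) -
          op (antiUnit i) • (A (plusProj J i (op (antiUnit i) • y)) : H)) := fun y => by
      rw [op_antiUnit_sq_smul, smul_sub, op_antiUnit_sq_smul, map_neg, map_neg,
        AddSubgroup.coe_neg, smul_neg, sub_neg_eq_add, sub_neg_eq_add, add_comm]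
    rw [RingHom.id_apply, hc', add_smul, mul_smul, add_smul, mul_smul, ← e1 w x, ← e2, ← e1 z x]
    simp only [map_add, smul_add, AddSubgroup.coe_add]
    abel
  cont := by
    have h : Continuous fun x : H => (A (plusProj J i x) : H) :=
      continuous_subtype_val.comp (A.continuous.comp continuous_plusProj)
    exact h.sub ((continuous_op_smul _).comp (h.comp (continuous_op_smul _)))

theorem extend_apply (A : plusGroup J i →L[ℂ] plusGroup J i) (x : H) :
    extend A x = (A (plusProj J i x) : H) -
      op (antiUnit i) • (A (plusProj J i (op (antiUnit i) • x)) : H) := rfl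

theorem extend_commute (A : plusGroup J i →L[ℂ] plusGroup J i) : extend A * J = J * extend A := by
  ext x
  change extend A (J x) = J (extend A x)
  rw [extend_apply, extend_apply, ← map_smul J, plusProj_apply_J, plusProj_apply_J, map_smul A,
    map_smul A, map_sub, map_smul J, plusGroup.apply_eq, plusGroup.apply_eq, plusGroup.coe_smul,
    plusGroup.coe_smul, iota_I]

theorem compress_extend (A : plusGroup J i →L[ℂ] plusGroup J i) : compress J i (extend A) = A := by
  ext1 x
  apply Subtype.ext
  rw [coe_compress (extend_commute A), extend_apply, plusProj_antiUnit_smul, plusProj_coe, map_zero]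
  simp

/-- `T` acts on the two orthogonal components of `x` through the same compression, so Pythagoras
gives the upper bound; unit vectors of `H₊^{Ji}` give the lower one. -/
theorem opNorm_eq_norm_compress {T : Op H} (hT : T * J = J * T) :
    opNorm T = ‖compress J i T‖ := by
  have hub : ∀ x : H, ‖x‖ = 1 → ‖T x‖ ≤ ‖compress J i T‖ := fun x hx => by
    refine (sq_le_sq₀ (norm_nonneg _) (norm_nonneg _)).1 ?_
    rw [apply_eq_compress (i := i) hT, norm_sub_antiUnit_smul_sq]
    have h1 : ‖plusProj J i x‖ ^ 2 + ‖plusProj J i (op (antiUnit i) • x)‖ ^ 2 = 1 := by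
      rw [← norm_sub_antiUnit_smul_sq, ← eq_plusProj_sub, hx, one_pow]
    have h2 : ∀ y, ‖compress J i T y‖ ^ 2 ≤ ‖compress J i T‖ ^ 2 * ‖y‖ ^ 2 := fun y => by
      rw [← mul_pow]
      gcongr
      exact (compress J i T).le_opNorm y
    refine (add_le_add (h2 _) (h2 _)).trans ?_
    rw [← mul_add, h1, mul_one]
  have hbdd : BddAbove {r | ∃ x : H, ‖x‖ = 1 ∧ r = ‖T x‖} :=
    ⟨_, by rintro _ ⟨x, hx, rfl⟩; exact hub x hx⟩
  have hnn : 0 ≤ opNorm T := Real.sSup_nonneg (by rintro _ ⟨x, -, rfl⟩; exact norm_nonneg _)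
  refine le_antisymm (Real.sSup_le (by rintro _ ⟨x, hx, rfl⟩; exact hub x hx) (norm_nonneg _)) ?_
  refine ContinuousLinearMap.opNorm_le_of_unit_norm hnn fun x hx => ?_
  refine le_csSup hbdd ⟨x, hx, ?_⟩
  change ‖(compress J i T x : H)‖ = _
  rw [coe_compress hT]

theorem isCompactOperator_compress {T : Op H} (hT : IsCompactOperator T) :
    IsCompactOperator (compress J i T) := by
  obtain ⟨C, hC, hCT⟩ := hT
  refine ⟨plusProj J i '' C, hC.image continuous_plusProj, ?_⟩
  have h1 : (Subtype.val : plusGroup J i → H) ⁻¹' (T ⁻¹' C) ∈ 𝓝 (0 : plusGroup J i) :=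
    continuous_subtype_val.continuousAt.preimage_mem_nhds (by simpa using hCT)
  exact mem_of_superset h1 fun x hx => ⟨T x, hx, rfl⟩

theorem isCompactOperator_of_compress {T : Op H} (hT : T * J = J * T)
    (h : IsCompactOperator (compress J i T)) : IsCompactOperator T := by
  obtain ⟨C, hC, hCT⟩ := h
  have hcont : Continuous fun z : plusGroup J i × plusGroup J i =>
      (z.1 : H) - op (antiUnit i) • (z.2 : H) :=
    (continuous_subtype_val.comp continuous_fst).sub
      ((continuous_op_smul _).comp (continuous_subtype_val.comp continuous_snd))
  refine ⟨_, (hC.prod hC).image hcont, ?_⟩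
  have h1 : plusProj J i ⁻¹' (compress J i T ⁻¹' C) ∈ 𝓝 (0 : H) :=
    continuous_plusProj.continuousAt.preimage_mem_nhds (by rwa [map_zero])
  have h2 : (fun x : H => op (antiUnit i) • x) ⁻¹'
      (plusProj J i ⁻¹' (compress J i T ⁻¹' C)) ∈ 𝓝 (0 : H) :=
    (continuous_op_smul _).continuousAt.preimage_mem_nhds (by rwa [smul_zero])
  refine mem_of_superset (inter_mem h1 h2) fun x hx => ?_
  exact ⟨(compress J i T (plusProj J i x), compress J i T (plusProj J i (op (antiUnit i) • x))),
    ⟨hx.1, hx.2⟩, (apply_eq_compress hT x).symm⟩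

end PlusSpace

end QuatSchatten

/-! ### Singular values and Schatten norms through the compression. -/

namespace QuatSchatten

open MeasureTheory Filter Topology

section SingularValues

variable {H : Type*} [NormedAddCommGroup H] [Module ℍ[ℝ]ᵐᵒᵖ H] [QuaternionicInner H]

theorem tsum_enorm_ip_sq_le {e : ℕ → H} {t : ℕ → Prop} [DecidablePred t]
    (he : ∀ m n, ip (e m) (e n) = if m = n ∧ t m then 1 else 0) {x : H} (hx : ‖x‖ ≤ 1) :
    ∑' k, ‖ip (e k) x‖ₑ ^ 2 ≤ 1 := by
  rw [ENNReal.tsum_eq_iSup_sum]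
  refine iSup_le fun s => ?_
  rw [sum_enorm_sq]
  exact ENNReal.ofReal_le_one.2 ((sum_norm_ip_sq_le he x s).trans (pow_le_one₀ (norm_nonneg _) hx))

theorem enorm_ip_comm (x y : H) : ‖ip x y‖ₑ = ‖ip y x‖ₑ := by
  rw [← ofReal_norm, ← star_ip, norm_star, ofReal_norm]

theorem norm_le_one_of_ip {e : ℕ → H} {t : ℕ → Prop} [DecidablePred t]
    (he : ∀ m n, ip (e m) (e n) = if m = n ∧ t m then 1 else 0) (n : ℕ) : ‖e n‖ ≤ 1 := by
  have h := he n n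
  rw [ip_self] at h
  have h2 : ‖e n‖ ^ 2 ≤ 1 := by
    by_cases ht : t n
    · rw [if_pos ⟨rfl, ht⟩, ← Quaternion.coe_one] at h
      exact (Quaternion.coe_injective h).le
    · rw [if_neg (by tauto), coe_eq_zero_iff] at h
      rw [h]; exact zero_le_one
  exact (sq_le_one_iff₀ (norm_nonneg _)).1 h2

-- The vectors at indices with `l n = 0` are unconstrained; setting them to `0` makes both families
-- Bessel without changing the sum.
open Classical in
theorem IsSingularValueSeq.exists_normalized {T : Op H} {l : ℕ → ℝ} (h : IsSingularValueSeq T l) :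
    ∃ e σ : ℕ → H, (∀ m n, ip (e m) (e n) = if m = n ∧ l m ≠ 0 then 1 else 0) ∧
      (∀ m n, ip (σ m) (σ n) = if m = n ∧ l m ≠ 0 then 1 else 0) ∧
      ∀ x, HasSum (fun n => op ((l n : ℍ[ℝ]) * ip (e n) x) • σ n) (T x) := by
  obtain ⟨-, -, e, σ, he, hσ, hT⟩ := h
  have key : ∀ f : ℕ → H,
      (∀ m n, l m ≠ 0 → l n ≠ 0 → ip (f m) (f n) = if m = n then 1 else 0) → ∀ m n,
      ip (if l m ≠ 0 then f m else 0) (if l n ≠ 0 then f n else 0) =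
        if m = n ∧ l m ≠ 0 then 1 else 0 := fun f hf m n => by
    by_cases hm : l m = 0
    · simp [hm, ip_zero_left]
    by_cases hn : l n = 0
    · have : m ≠ n := by rintro rfl; exact hm hn
      simp [hn, ip_zero_right, this]
    · simp [hm, hn, hf m n hm hn]
  refine ⟨fun n => if l n ≠ 0 then e n else 0, fun n => if l n ≠ 0 then σ n else 0, key e he,
    key σ hσ, fun x => ?_⟩
  convert! hT x using 2 with n
  by_cases hn : l n = 0 <;> simp [hn]

/-- The `ℓ^r`-norm of the singular values does not depend on the decomposition. -/
theorem tsum_singularValueSeq_le {T : Op H} {l m : ℕ → ℝ} (hl : IsSingularValueSeq T l)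
    (hm : IsSingularValueSeq T m) {r : ℝ} (hr : 1 ≤ r) :
    ∑' k, ‖m k‖ₑ ^ r ≤ ∑' k, ‖l k‖ₑ ^ r := by
  classical
  obtain ⟨e, σ, he, hσ, hT⟩ := hl.exists_normalized
  obtain ⟨u, v, hu, hv, hT'⟩ := hm.exists_normalized
  -- As `T (u k) = v k * m k`, each nonzero `m k` is the entry `⟨v k, T (u k)⟩`. Expanded in the
  -- other decomposition, it falls under the Schur test.
  refine le_trans ?_ (tsum_rpow_tsum_mul_le (α := fun k n => ‖ip (e n) (u k)‖ₑ)
    (β := fun k n => ‖ip (v k) (σ n)‖ₑ) (l := fun n => ‖l n‖ₑ)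
    (fun k => tsum_enorm_ip_sq_le he (norm_le_one_of_ip hu k))
    (fun n => by
      simp only [enorm_ip_comm (e n)]
      exact tsum_enorm_ip_sq_le hu (norm_le_one_of_ip he n))
    (fun k => by
      simp only [enorm_ip_comm (v k)]
      exact tsum_enorm_ip_sq_le hσ (norm_le_one_of_ip hv k))
    (fun n => tsum_enorm_ip_sq_le hv (norm_le_one_of_ip hσ n)) hr)
  refine ENNReal.tsum_le_tsum fun k => ENNReal.rpow_le_rpow ?_ (by linarith)
  by_cases hk : m k = 0
  · simp [hk]
  have h1 : T (u k) = op (m k : ℍ[ℝ]) • v k := by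
    refine (hT' (u k)).unique ?_
    have h2 := hasSum_single (f := fun n => op ((m n : ℍ[ℝ]) * ip (u n) (u k)) • v n) k
      fun n hn => by rw [hu, if_neg (fun h => hn h.1)]; simp
    rwa [hu, if_pos ⟨rfl, hk⟩, mul_one] at h2
  have h2 : ip (v k) (T (u k)) = (m k : ℍ[ℝ]) := by
    rw [h1, ip_smul_right, hv, if_pos ⟨rfl, hk⟩, one_mul]
  have h3 : ‖m k‖ₑ = ‖ip (v k) (T (u k))‖ₑ := by
    rw [h2, ← ofReal_norm, ← ofReal_norm, Quaternion.norm_coe]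
  have h4 := (hT (u k)).map (ipHom (v k)) (continuous_ip (v k))
  have h5 : ip (v k) (T (u k)) = ∑' n, ip (v k) (σ n) * ((l n : ℍ[ℝ]) * ip (e n) (u k)) := by
    rw [← ipHom_apply, ← h4.tsum_eq]
    exact tsum_congr fun n => ip_smul_right _ _ _
  rw [h3, h5]
  refine enorm_tsum_le_tsum_enorm.trans (le_of_eq (tsum_congr fun n => ?_))
  have h6 : ‖(l n : ℍ[ℝ])‖ₑ = ‖l n‖ₑ := by
    rw [← ofReal_norm, ← ofReal_norm, Quaternion.norm_coe]
  have h7 : ∀ a b : ℍ[ℝ], ‖a * b‖ₑ = ‖a‖ₑ * ‖b‖ₑ := fun a b => by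
    rw [← ofReal_norm, norm_mul, ENNReal.ofReal_mul (norm_nonneg _), ofReal_norm, ofReal_norm]
  rw [h7, h7, h6]
  ring

variable {J : Op H} [IsImaginary J] {i : imaginaryUnits}

/-- Orthonormal vectors of `H₊^{Ji}` are orthonormal over the quaternions, scalar products there
being already in `ℂ_i`; the expansion passes to `H` through both components of `x`. The
multiplicities therefore agree. -/
theorem IsSVD.isSingularValueSeq {T : Op H} (hT : T * J = J * T) {l : ℕ → ℝ}
    {e σ : ℕ → plusGroup J i} (h : IsSVD (compress J i T) l e σ) : IsSingularValueSeq T l := by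
  have horth : ∀ f : ℕ → plusGroup J i,
      (∀ m n, (inner ℂ (f m) (f n) : ℂ) = if m = n ∧ l m ≠ 0 then 1 else 0) →
      ∀ m n, l m ≠ 0 → l n ≠ 0 → ip (f m : H) (f n : H) = if m = n then 1 else 0 :=
    fun f hf m n hm _ => by
      rw [← iota_inner, hf]
      by_cases hmn : m = n <;> simp [hmn, hm]
      simp [← hmn, hm]
  refine ⟨h.antitone, h.nonneg, fun n => e n, fun n => σ n, horth e h.inner_left,
    horth σ h.inner_right, fun x => ?_⟩
  have hval : ∀ u : plusGroup J i, HasSum (fun n => op ((l n : ℍ[ℝ]) * ip (e n : H) (u : H)) •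
      (σ n : H)) (compress J i T u : H) := fun u => by
    have h1 := (h.expansion u).map (plusGroup J i).subtype continuous_subtype_val
    convert! h1 using 2 with n
    simp only [Function.comp_apply, AddSubgroup.subtype_apply]
    rw [plusGroup.coe_smul, map_mul, iota_inner, iota_ofReal]
  rw [apply_eq_compress (i := i) hT]
  have h2 := (hval (plusProj J i (op (antiUnit i) • x))).map
    (DistribSMul.toAddMonoidHom H (op (antiUnit i))) (continuous_op_smul _)
  convert! (hval (plusProj J i x)).sub h2 using 2 with n
  simp only [Function.comp_apply, DistribSMul.toAddMonoidHom_apply]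
  rw [smul_smul, ← op_mul, ← sub_smul, ← op_sub, mul_assoc, ← mul_sub]
  congr 3
  nth_rewrite 1 [eq_plusProj_sub (J := J) (i := i) x]
  rw [ip_sub_right, ip_smul_right]

variable [CompleteSpace H]

/-- `singularValues` is picked by choice; independence of the decomposition replaces it by the
singular values of the compression. -/
theorem tsum_singularValues_eq {T : Op H} (hT : T * J = J * T)
    (hc : IsCompactOperator (compress J i T)) {p : ℝ≥0∞} (hp : 1 ≤ p) (hp' : p ≠ ∞) :
    (∀ n, 0 ≤ singularValues T n) ∧
      ∑' n, ‖singularValues T n ^ p.toReal‖ₑ = varNorm p (compress J i T) ^ p.toReal := by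
  have hP : 1 ≤ p.toReal := by simpa using ENNReal.toReal_mono hp' hp
  obtain ⟨l, e, σ, h⟩ := exists_isSVD hc
  have hl := h.isSingularValueSeq hT
  have hs : IsSingularValueSeq T (singularValues T) := by
    have hex : ∃ l, IsSingularValueSeq T l := ⟨l, hl⟩
    rw [singularValues, dif_pos hex]
    exact hex.choose_spec
  have h0 := hs.2.1
  refine ⟨h0, ?_⟩
  rw [h.varNorm_eq hp hp', seqNorm_rpow (zero_lt_one.trans_le hp).ne' hp']
  have h1 : ∀ n, ‖singularValues T n ^ p.toReal‖ₑ = ‖singularValues T n‖ₑ ^ p.toReal := fun n => by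
    rw [← ofReal_norm, ← ofReal_norm, ENNReal.ofReal_rpow_of_nonneg (norm_nonneg _) (by linarith),
      Real.norm_of_nonneg (h0 n), Real.norm_of_nonneg (Real.rpow_nonneg (h0 n) _)]
  have h2 : ∀ n, ‖(l n : ℂ)‖ₑ = ‖l n‖ₑ := fun n => by
    rw [← ofReal_norm, Complex.norm_real, ofReal_norm]
  simp only [h1, h2]
  exact le_antisymm (tsum_singularValueSeq_le hl hs hP) (tsum_singularValueSeq_le hs hl hP)

theorem mem_schattenClass_iff (i : imaginaryUnits) {p : ℝ≥0∞} (hp : 1 ≤ p) {T : Op H} :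
    T ∈ schattenClass J p ↔ T * J = J * T ∧ varNorm p (compress J i T) ≠ ∞ := by
  refine and_congr_right fun hT => ?_
  have hp0 : p ≠ 0 := (zero_lt_one.trans_le hp).ne'
  rcases eq_or_ne p ∞ with rfl | hp'
  · simp [varNorm_top]
  have hP := ENNReal.toReal_pos hp0 hp'
  have hiff : IsCompactOperator (compress J i T) →
      ((Summable fun n => singularValues T n ^ p.toReal) ↔ varNorm p (compress J i T) ≠ ∞) := by
    intro hc
    obtain ⟨h0, h1⟩ := tsum_singularValues_eq hT hc hp hp'
    rw [← summable_norm_iff, ← tsum_enorm_ne_top_iff_summable_norm, h1, Ne, Ne,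
      ENNReal.rpow_eq_top_iff_of_pos hP]
  constructor
  · intro h
    obtain ⟨hc, hs⟩ := h hp'
    exact (hiff (isCompactOperator_compress hc)).1 hs
  · intro h _
    have hc := isCompactOperator_of_varNorm_ne_top hp0 hp' h
    exact ⟨isCompactOperator_of_compress hT hc, (hiff hc).2 h⟩

theorem schattenNorm_eq (i : imaginaryUnits) {p : ℝ≥0∞} (hp : 1 ≤ p) {T : Op H}
    (hT : T ∈ schattenClass J p) : schattenNorm p T = (varNorm p (compress J i T)).toReal := by
  obtain ⟨hTJ, hfin⟩ := (mem_schattenClass_iff i hp).1 hT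
  have hp0 : p ≠ 0 := (zero_lt_one.trans_le hp).ne'
  rcases eq_or_ne p ∞ with rfl | hp'
  · rw [schattenNorm, if_pos rfl, varNorm_top, toReal_enorm, opNorm_eq_norm_compress hTJ]
  have hP := ENNReal.toReal_pos hp0 hp'
  obtain ⟨h0, h1⟩ := tsum_singularValues_eq hTJ
    (isCompactOperator_of_varNorm_ne_top hp0 hp' hfin) hp hp'
  have h2 : ∑' n, singularValues T n ^ p.toReal = (varNorm p (compress J i T) ^ p.toReal).toReal := by
    rw [← h1, ENNReal.tsum_toReal_eq (fun _ => enorm_ne_top)]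
    refine tsum_congr fun n => ?_
    rw [toReal_enorm, Real.norm_of_nonneg (Real.rpow_nonneg (h0 n) _)]
  rw [schattenNorm, if_neg hp', h2, ENNReal.toReal_rpow, ← ENNReal.rpow_mul,
    mul_one_div_cancel hP.ne', ENNReal.rpow_one]

theorem extend_mem_schattenClass {p : ℝ≥0∞} (hp : 1 ≤ p) {A : plusGroup J i →L[ℂ] plusGroup J i}
    (hA : varNorm p A ≠ ∞) : extend A ∈ schattenClass J p :=
  (mem_schattenClass_iff i hp).2 ⟨extend_commute A, by rwa [compress_extend]⟩

theorem norm_planeScalar (i : imaginaryUnits) (a₀ a₁ : ℝ) :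
    ‖planeScalar i a₀ a₁‖ = ‖(⟨a₀, a₁⟩ : ℂ)‖ := by
  rw [← norm_iota i, iota_apply]

/-- The Schatten classes are normed spaces over `ℂ_i`. -/
theorem isNormedSchatten (i : imaginaryUnits) {p : ℝ≥0∞} (hp : 1 ≤ p) :
    IsNormedSchatten J i p := by
  have hp0 : p ≠ 0 := (zero_lt_one.trans_le hp).ne'
  have hzero : (0 : Op H) ∈ schattenClass J p := by
    rw [mem_schattenClass_iff i hp, compress_zero, varNorm_zero]
    simp
  have hadd : ∀ T ∈ schattenClass J p, ∀ S ∈ schattenClass J p, T + S ∈ schattenClass J p := by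
    intro T hT S hS
    rw [mem_schattenClass_iff i hp] at hT hS ⊢
    refine ⟨by rw [add_mul, mul_add, hT.1, hS.1], ?_⟩
    rw [compress_add]
    exact ne_top_of_le_ne_top (ENNReal.add_ne_top.2 ⟨hT.2, hS.2⟩) (varNorm_add_le hp _ _)
  have hsmul : ∀ a₀ a₁ : ℝ, ∀ T ∈ schattenClass J p, leftSMul J a₀ a₁ T ∈ schattenClass J p := by
    intro a₀ a₁ T hT
    rw [mem_schattenClass_iff i hp] at hT ⊢
    refine ⟨leftSMul_commute hT.1, ?_⟩
    rw [compress_leftSMul, varNorm_smul]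
    exact ENNReal.mul_ne_top enorm_ne_top hT.2
  refine ⟨hzero, hadd, hsmul, fun T hT => ?_, fun T hT => ?_, fun T hT S hS => ?_,
    fun a₀ a₁ T hT => ?_⟩
  · rw [schattenNorm_eq i hp hT]
    exact ENNReal.toReal_nonneg
  · rw [schattenNorm_eq i hp hT]
    have hT' := (mem_schattenClass_iff i hp).1 hT
    rw [ENNReal.toReal_eq_zero_iff, or_iff_left hT'.2]
    constructor
    · intro h
      refine compress_injective (i := i) hT'.1 (by simp) ?_
      rw [varNorm_eq_zero hp0 h, compress_zero]
    · rintro rfl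
      rw [compress_zero, varNorm_zero]
  · rw [schattenNorm_eq i hp hT, schattenNorm_eq i hp hS, schattenNorm_eq i hp (hadd T hT S hS)]
    have hT' := (mem_schattenClass_iff i hp).1 hT
    have hS' := (mem_schattenClass_iff i hp).1 hS
    rw [← ENNReal.toReal_add hT'.2 hS'.2, compress_add]
    exact ENNReal.toReal_mono (ENNReal.add_ne_top.2 ⟨hT'.2, hS'.2⟩) (varNorm_add_le hp _ _)
  · rw [schattenNorm_eq i hp hT, schattenNorm_eq i hp (hsmul a₀ a₁ T hT), compress_leftSMul,
      varNorm_smul, ENNReal.toReal_mul, toReal_enorm, norm_planeScalar]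

end SingularValues

/-! ### The trace pairing on `H` and the duality theorem. -/

section JTrace

variable {H : Type*} [NormedAddCommGroup H] [Module ℍ[ℝ]ᵐᵒᵖ H] [QuaternionicInner H]
  [CompleteSpace H] {J : Op H} [IsImaginary J] {i : imaginaryUnits}

theorem exists_isONB (J : Op H) [IsImaginary J] (i : imaginaryUnits) : ∃ B, IsONB J i B := by
  obtain ⟨w, b, hb⟩ := exists_hilbertBasis ℂ (plusGroup J i)
  have horth := b.orthonormal
  rw [hb] at horth
  refine ⟨Subtype.val '' w, ?_, ?_, ?_, ?_⟩
  · rintro _ ⟨x, -, rfl⟩; exact x.2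
  · rintro _ ⟨x, hx, rfl⟩; exact horth.1 ⟨x, hx⟩
  · rintro _ ⟨x, hx, rfl⟩ _ ⟨y, hy, rfl⟩ hxy
    have hne : (⟨x, hx⟩ : w) ≠ ⟨y, hy⟩ := fun h =>
      hxy (congrArg (fun z : w => ((z : plusGroup J i) : H)) h)
    have := horth.2 hne
    rw [← iota_inner]
    simp only at this
    rw [this, map_zero]
  · intro x hx h
    have h1 : (⟨x, hx⟩ : plusGroup J i) = 0 := by
      have h2 := b.hasSum_repr ⟨x, hx⟩
      have h3 : ∀ k, b.repr ⟨x, hx⟩ k • b k = 0 := fun k => by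
        have h4 := h (k : plusGroup J i) ⟨k, k.2, rfl⟩
        rw [← norm_eq_zero] at h4
        have h5 := norm_inner_plus (k : plusGroup J i) ⟨x, hx⟩
        rw [h4, norm_eq_zero] at h5
        rw [b.repr_apply_apply, hb, h5, zero_smul]
      simp only [h3] at h2
      exact h2.unique hasSum_zero
    exact congrArg Subtype.val h1

/-- Totality of `B` says that its span has trivial orthogonal complement in `H₊^{Ji}`, so `B` is a
Hilbert basis and the basis independence of the complex trace applies. -/
theorem hasSum_ip_of_isONB {T : Op H} (hT : T * J = J * T) (hT1 : varNorm 1 (compress J i T) ≠ ∞)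
    {B : Set H} (hB : IsONB J i B) :
    HasSum (fun e : B => ip (e : H) (T e)) (iota i (opTrace (compress J i T))) := by
  obtain ⟨hsub, hnorm, horth, htot⟩ := hB
  let b : B → plusGroup J i := fun x => ⟨x, hsub x.2⟩
  have hb : Orthonormal ℂ b := by
    refine ⟨fun x => hnorm x x.2, fun x y hxy => ?_⟩
    have h1 := norm_inner_plus (b x) (b y)
    rw [horth x x.2 y y.2 (fun h => hxy (Subtype.ext h)), norm_zero, norm_eq_zero] at h1
    exact h1
  have hbot : (Submodule.span ℂ (Set.range b))ᗮ = ⊥ := by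
    rw [Submodule.eq_bot_iff]
    intro x hx
    refine Subtype.ext (htot x x.2 fun e he => ?_)
    have h1 := (Submodule.mem_orthogonal _ _).1 hx (b ⟨e, he⟩)
      (Submodule.subset_span ⟨⟨e, he⟩, rfl⟩)
    have h2 := iota_inner (b ⟨e, he⟩) x
    rw [h1, map_zero] at h2
    exact h2.symm
  have h := hasSum_opTrace hT1 (HilbertBasis.mkOfOrthogonalEqBot hb hbot)
  rw [HilbertBasis.coe_mkOfOrthogonalEqBot] at h
  have hcont : Continuous (iota i) := AddMonoidHomClass.continuous_of_bound (iota i) 1 fun z => by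
    rw [norm_iota, one_mul]
  convert! h.map (iota i) hcont using 2 with x
  rw [Function.comp_apply, iota_inner, coe_compress hT]

theorem jTrace_eq {T : Op H} (hT : T * J = J * T) (hT1 : varNorm 1 (compress J i T) ≠ ∞) :
    jTrace J i T = iota i (opTrace (compress J i T)) := by
  have hex := exists_isONB J i
  rw [jTrace, dif_pos hex]
  exact (hasSum_ip_of_isONB hT hT1 hex.choose_spec).tsum_eq

omit [QuaternionicInner H] [CompleteSpace H] [IsImaginary J] in
theorem mul_commute {T S : Op H} (hT : T * J = J * T) (hS : S * J = J * S) :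
    (T * S) * J = J * (T * S) := by
  rw [mul_assoc, hS, ← mul_assoc, hT, mul_assoc]

variable {p q : ℝ≥0∞}

theorem varNorm_compress_mul_ne_top (hpq : p.HolderConjugate q) (hp : p ≠ ∞) {T S : Op H}
    (hT : T ∈ schattenClass J p) (hS : S ∈ schattenClass J q) :
    varNorm 1 (compress J i T * compress J i S) ≠ ∞ :=
  varNorm_mul_ne_top hpq hp ((mem_schattenClass_iff i (hpq.one_le p q)).1 hT).2
    ((mem_schattenClass_iff i (hpq.symm.one_le q p)).1 hS).2

theorem mul_mem_schattenClass (i : imaginaryUnits) (hpq : p.HolderConjugate q) (hp : p ≠ ∞)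
    {T S : Op H} (hT : T ∈ schattenClass J p) (hS : S ∈ schattenClass J q) :
    T * S ∈ schattenClass J 1 := by
  rw [mem_schattenClass_iff i le_rfl, compress_mul _ hS.1]
  exact ⟨mul_commute hT.1 hS.1, varNorm_compress_mul_ne_top hpq hp hT hS⟩

theorem jTrace_mul_eq (hpq : p.HolderConjugate q) (hp : p ≠ ∞)
    {T S : Op H} (hT : T ∈ schattenClass J p) (hS : S ∈ schattenClass J q) :
    jTrace J i (T * S) = iota i (opTrace (compress J i T * compress J i S)) := by
  have h := varNorm_compress_mul_ne_top (i := i) hpq hp hT hS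
  rw [← compress_mul _ hS.1] at h ⊢
  exact jTrace_eq (mul_commute hT.1 hS.1) h

theorem norm_jTrace_mul_le (i : imaginaryUnits) (hpq : p.HolderConjugate q) (hp : p ≠ ∞)
    {T S : Op H} (hT : T ∈ schattenClass J p) (hS : S ∈ schattenClass J q) :
    ‖jTrace J i (T * S)‖ ≤ schattenNorm p T * schattenNorm q S := by
  have hp1 := hpq.one_le p q
  have hq1 := hpq.symm.one_le q p
  have hT' := ((mem_schattenClass_iff i hp1).1 hT).2
  have hS' := ((mem_schattenClass_iff i hq1).1 hS).2
  rw [jTrace_mul_eq hpq hp hT hS, norm_iota, schattenNorm_eq i hp1 hT, schattenNorm_eq i hq1 hS,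
    ← ENNReal.toReal_mul, ← toReal_enorm]
  exact ENNReal.toReal_mono (ENNReal.mul_ne_top hT' hS') (enorm_opTrace_mul_le hpq hp hT' hS')

/-- The functional `Tr_{Ji}(· S)`. -/
noncomputable def traceFunctional (J : Op H) [IsImaginary J] (i : imaginaryUnits)
    (hpq : p.HolderConjugate q) (hp : p ≠ ∞) (S : schattenClass J q) : SchattenDual J i p where
  toFun T := jTrace J i ((T : Op H) * (S : Op H))
  mem_plane' T := by
    rw [jTrace_mul_eq hpq hp T.2 S.2]
    exact mem_complexPlane_iff.2 ⟨_, rfl⟩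
  map_add' T T' R hR := by
    rw [jTrace_mul_eq hpq hp T.2 S.2, jTrace_mul_eq hpq hp T'.2 S.2, jTrace_mul_eq hpq hp R.2 S.2,
      hR, compress_add, add_mul, opTrace_add (varNorm_compress_mul_ne_top hpq hp T.2 S.2)
      (varNorm_compress_mul_ne_top hpq hp T'.2 S.2), map_add]
  map_smul' a₀ a₁ T R hR := by
    rw [jTrace_mul_eq hpq hp T.2 S.2, jTrace_mul_eq hpq hp R.2 S.2, hR, compress_leftSMul,
      smul_mul_assoc, opTrace_smul _ (varNorm_compress_mul_ne_top hpq hp T.2 S.2), map_mul,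
      iota_apply i ⟨a₀, a₁⟩]
  bound' := ⟨schattenNorm q (S : Op H), fun T => by
    rw [mul_comm]
    exact norm_jTrace_mul_le i hpq hp T.2 S.2⟩

theorem traceFunctional_apply (hpq : p.HolderConjugate q) (hp : p ≠ ∞) (S : schattenClass J q)
    (T : schattenClass J p) :
    (traceFunctional J i hpq hp S).toFun T = iota i (opTrace (compress J i T * compress J i S)) :=
  jTrace_mul_eq hpq hp T.2 S.2

theorem traceFunctional_injective (hpq : p.HolderConjugate q) (hp : p ≠ ∞) :
    Function.Injective (traceFunctional J i hpq hp) := by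
  intro S S' h
  have hp1 := hpq.one_le p q
  have hq1 := hpq.symm.one_le q p
  have hS := (mem_schattenClass_iff i hq1).1 S.2
  have hS' := (mem_schattenClass_iff i hq1).1 S'.2
  have hq0 : q ≠ 0 := (zero_lt_one.trans_le hq1).ne'
  refine Subtype.ext (compress_injective (i := i) hS.1 hS'.1 (sub_eq_zero.1 ?_))
  have hneg : varNorm q ((-1 : ℂ) • compress J i (S' : Op H)) ≠ ∞ := by
    rw [varNorm_smul]; exact ENNReal.mul_ne_top enorm_ne_top hS'.2
  have hsub : compress J i (S : Op H) - compress J i (S' : Op H) =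
      compress J i (S : Op H) + (-1 : ℂ) • compress J i (S' : Op H) := by
    rw [neg_one_smul, sub_eq_add_neg]
  refine varNorm_eq_zero hq0 (nonpos_iff_eq_zero.1 ?_)
  rw [hsub]
  -- Applied with constant `0`: the difference of the compressions pairs to zero with every operator
  -- of finite norm.
  refine varNorm_le_of_forall_opTrace_le hpq hp (ne_top_of_le_ne_top
    (ENNReal.add_ne_top.2 ⟨hS.2, hneg⟩) (varNorm_add_le hq1 _ _)) fun A hA => ?_
  have h1 := congrArg (fun ξ => planeCoord i (SchattenDual.toFun ξ
    ⟨extend A, extend_mem_schattenClass hp1 hA⟩)) h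
  simp only [traceFunctional_apply, planeCoord_iota, compress_extend] at h1
  rw [mul_add, mul_smul_comm, opTrace_add (varNorm_mul_ne_top hpq hp hA hS.2)
    (by rw [varNorm_smul]
        exact ENNReal.mul_ne_top enorm_ne_top (varNorm_mul_ne_top hpq hp hA hS'.2)),
    opTrace_smul _ (varNorm_mul_ne_top hpq hp hA hS'.2), h1]
  simp

omit [CompleteSpace H] in
theorem extend_add (A B : plusGroup J i →L[ℂ] plusGroup J i) :
    extend (A + B) = extend A + extend B := by
  refine compress_injective (i := i) (extend_commute _) ?_ ?_
  · rw [add_mul, mul_add, extend_commute, extend_commute]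
  · rw [compress_add, compress_extend, compress_extend, compress_extend]

omit [CompleteSpace H] in
theorem extend_smul (c : ℂ) (A : plusGroup J i →L[ℂ] plusGroup J i) :
    extend (c • A) = leftSMul J c.re c.im (extend A) := by
  refine compress_injective (i := i) (extend_commute _) (leftSMul_commute (extend_commute _)) ?_
  rw [compress_leftSMul, compress_extend, compress_extend]

omit [CompleteSpace H] in
theorem extend_compress {T : Op H} (hT : T * J = J * T) : extend (compress J i T) = T :=
  compress_injective (i := i) (extend_commute _) hT (compress_extend _)

/-- The functional is transported to `H₊^{Ji}` by `extend`, represented there by an operator, and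
that operator is extended back to `H`. -/
theorem traceFunctional_surjective (hpq : p.HolderConjugate q) (hp : p ≠ ∞) :
    Function.Surjective (traceFunctional J i hpq hp) := by
  intro ξ
  have hp1 := hpq.one_le p q
  have hq1 := hpq.symm.one_le q p
  obtain ⟨C, hC⟩ := ξ.bound'
  have hcoord : ∀ T, iota i (planeCoord i (ξ.toFun T)) = ξ.toFun T := fun T => by
    obtain ⟨z, hz⟩ := mem_complexPlane_iff.1 (ξ.mem_plane' T)
    rw [hz, planeCoord_iota]
  let E : schattenSubmodule (plusGroup J i) hp1 → schattenClass J p := fun A =>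
    ⟨extend (A : plusGroup J i →L[ℂ] plusGroup J i), extend_mem_schattenClass hp1 A.2⟩
  let η : schattenSubmodule (plusGroup J i) hp1 →ₗ[ℂ] ℂ :=
    { toFun := fun A => planeCoord i (ξ.toFun (E A))
      map_add' := fun A B => by
        rw [ξ.map_add' (E A) (E B) (E (A + B)) (extend_add _ _), planeCoord_add]
      map_smul' := fun c A => by
        rw [ξ.map_smul' c.re c.im (E A) (E (c • A)) (extend_smul _ _), ← iota_apply,
          planeCoord_iota_mul]
        rfl }
  have hη : ∀ A, ‖η A‖ₑ ≤
      ENNReal.ofReal C * varNorm p (A : plusGroup J i →L[ℂ] plusGroup J i) := fun A => by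
    have h1 := hC (E A)
    rw [← hcoord, norm_iota, schattenNorm_eq i hp1 (E A).2, compress_extend] at h1
    rw [← ofReal_norm]
    refine (ENNReal.ofReal_le_ofReal h1).trans ?_
    rw [ENNReal.ofReal_mul' ENNReal.toReal_nonneg, ENNReal.ofReal_toReal A.2]
  obtain ⟨S, hS, hSη⟩ := exists_opTrace_eq hpq hp hp1 η ENNReal.ofReal_ne_top hη
  refine ⟨⟨extend S, extend_mem_schattenClass hq1
    (ne_top_of_le_ne_top ENNReal.ofReal_ne_top hS)⟩, ?_⟩
  refine SchattenDual.ext (funext fun T => ?_)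
  have hT := (mem_schattenClass_iff i hp1).1 T.2
  have h1 := hSη ⟨compress J i T, hT.2⟩
  rw [traceFunctional_apply, compress_extend, ← h1, ← hcoord T]
  change iota i (planeCoord i (ξ.toFun (E _))) = _
  congr 3
  exact Subtype.ext (extend_compress hT.1)

/-- One inequality is Hölder's. For the other, each nonzero test operator on `H₊^{Ji}` is normalized
and extended to the unit ball of `S_p(J)`, and `varNorm_le_of_forall_opTrace_le` recovers the norm
of `S`. -/
theorem dualNorm_traceFunctional (hpq : p.HolderConjugate q) (hp : p ≠ ∞) (S : schattenClass J q) :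
    dualNorm (traceFunctional J i hpq hp S) = schattenNorm q (S : Op H) := by
  have hp1 := hpq.one_le p q
  have hq1 := hpq.symm.one_le q p
  have hS := (mem_schattenClass_iff i hq1).1 S.2
  have hSn : 0 ≤ schattenNorm q (S : Op H) := (isNormedSchatten i hq1).norm_nonneg _ S.2
  have hub : ∀ T : schattenClass J p, schattenNorm p (T : Op H) ≤ 1 →
      ‖(traceFunctional J i hpq hp S).toFun T‖ ≤ schattenNorm q (S : Op H) := fun T hT =>
    (norm_jTrace_mul_le i hpq hp T.2 S.2).trans (mul_le_of_le_one_left hSn hT)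
  have hbdd : BddAbove {r | ∃ T : schattenClass J p, schattenNorm p (T : Op H) ≤ 1 ∧
      r = ‖(traceFunctional J i hpq hp S).toFun T‖} :=
    ⟨_, by rintro _ ⟨T, hT, rfl⟩; exact hub T hT⟩
  refine le_antisymm (Real.sSup_le (by rintro _ ⟨T, hT, rfl⟩; exact hub T hT) hSn) ?_
  rw [schattenNorm_eq i hq1 S.2]
  have hD : 0 ≤ dualNorm (traceFunctional J i hpq hp S) :=
    Real.sSup_nonneg (by rintro _ ⟨T, -, rfl⟩; exact norm_nonneg _)
  refine ENNReal.toReal_le_of_le_ofReal hD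
    (varNorm_le_of_forall_opTrace_le hpq hp hS.2 fun A hA => ?_)
  rcases eq_or_ne (varNorm p A) 0 with h0 | h0
  · rw [varNorm_eq_zero (zero_lt_one.trans_le hp1).ne' h0, zero_mul]
    simp [opTrace]
  set N := (varNorm p A).toReal with hN
  have hNpos : 0 < N := ENNReal.toReal_pos h0 hA
  have hAN : varNorm p (((N⁻¹ : ℝ) : ℂ) • A) = 1 := by
    rw [varNorm_smul, ← ofReal_norm, Complex.norm_real, Real.norm_of_nonneg (by positivity),
      ENNReal.ofReal_inv_of_pos hNpos, hN, ENNReal.ofReal_toReal hA, ENNReal.inv_mul_cancel h0 hA]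
  have hmem := extend_mem_schattenClass hp1
    (A := ((N⁻¹ : ℝ) : ℂ) • A) (by rw [hAN]; exact ENNReal.one_ne_top)
  have h1 : ‖(traceFunctional J i hpq hp S).toFun ⟨_, hmem⟩‖ ≤
      dualNorm (traceFunctional J i hpq hp S) := by
    refine le_csSup hbdd ⟨_, ?_, rfl⟩
    rw [schattenNorm_eq i hp1 hmem, compress_extend, hAN]
    simp
  rw [traceFunctional_apply, norm_iota, compress_extend, smul_mul_assoc,
    opTrace_smul _ (varNorm_mul_ne_top hpq hp hA hS.2), norm_mul, Complex.norm_real,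
    Real.norm_of_nonneg (by positivity), inv_mul_le_iff₀ hNpos] at h1
  rw [← ofReal_norm]
  refine (ENNReal.ofReal_le_ofReal h1).trans (le_of_eq ?_)
  rw [ENNReal.ofReal_mul hNpos.le, hN, ENNReal.ofReal_toReal hA, mul_comm]

end JTrace

end QuatSchatten

theorem theorem3 {H : Type*} [NormedAddCommGroup H] [Module ℍ[ℝ]ᵐᵒᵖ H] [QuaternionicInner H]
    [CompleteSpace H] [TopologicalSpace.SeparableSpace H]
    (J : Op H) (hJ : IsAntiSelfAdjoint J) (hJ' : IsUnitary J)
    (i : ℍ[ℝ]) (hi : i ∈ imaginaryUnits)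
    (p q : ℝ≥0∞) (hp : 1 ≤ p) (hp' : p ≠ ∞) (hpq : p⁻¹ + q⁻¹ = 1) :
    IsNormedSchatten J i p ∧ IsNormedSchatten J i q ∧
    -- the trace `Tr_{Ji}(TS)` exists and does not depend on the basis
    (∀ T ∈ schattenClass J p, ∀ S ∈ schattenClass J q, T * S ∈ schattenClass J 1 ∧
      ∀ B : Set H, IsONB J i B →
        HasSum (fun e : B => ip (e : H) ((T * S) e)) (jTrace J i (T * S))) ∧
    -- the pairing identifies `S_q(J)` with the dual of `S_p(J)`, `ℂ_i`-linearly and isometrically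
    ∃ Φ : schattenClass J q ≃ SchattenDual J i p,
      (∀ (S : schattenClass J q) (T : schattenClass J p),
        (Φ S).toFun T = jTrace J i ((T : Op H) * (S : Op H))) ∧
      (∀ S : schattenClass J q, dualNorm (Φ S) = schattenNorm q (S : Op H)) ∧
      (∀ S S' R : schattenClass J q, (R : Op H) = (S : Op H) + (S' : Op H) →
        ∀ T, (Φ R).toFun T = (Φ S).toFun T + (Φ S').toFun T) ∧
      (∀ (a₀ a₁ : ℝ) (S R : schattenClass J q), (R : Op H) = leftSMul J a₀ a₁ (S : Op H) →
        ∀ T, (Φ R).toFun T = planeScalar i a₀ a₁ * (Φ S).toFun T) := by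
  have : IsImaginary J := isImaginary_of hJ hJ'
  have hc : p.HolderConjugate q := ENNReal.holderConjugate_iff.2 hpq
  have hq : 1 ≤ q := hc.symm.one_le q p
  let u : imaginaryUnits := ⟨i, hi⟩
  refine ⟨isNormedSchatten u hp, isNormedSchatten u hq, fun T hT S hS =>
    ⟨mul_mem_schattenClass u hc hp' hT hS, fun B hB => ?_⟩,
    Equiv.ofBijective (traceFunctional J u hc hp')
      ⟨traceFunctional_injective hc hp', traceFunctional_surjective hc hp'⟩,
    fun S T => rfl, dualNorm_traceFunctional hc hp', fun S S' R hR T => ?_,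
    fun a₀ a₁ S R hR T => ?_⟩
  · have hTS := varNorm_compress_mul_ne_top (i := u) hc hp' hT hS
    rw [← compress_mul _ hS.1] at hTS
    rw [show jTrace J i (T * S) = _ from jTrace_eq (i := u) (mul_commute hT.1 hS.1) hTS]
    exact hasSum_ip_of_isONB (i := u) (mul_commute hT.1 hS.1) hTS hB
  · change (traceFunctional J u hc hp' R).toFun T = (traceFunctional J u hc hp' S).toFun T +
      (traceFunctional J u hc hp' S').toFun T
    simp only [traceFunctional_apply]
    rw [hR, compress_add, mul_add, opTrace_add (varNorm_compress_mul_ne_top hc hp' T.2 S.2)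
      (varNorm_compress_mul_ne_top hc hp' T.2 S'.2), map_add]
  · change (traceFunctional J u hc hp' R).toFun T =
      planeScalar i a₀ a₁ * (traceFunctional J u hc hp' S).toFun T
    simp only [traceFunctional_apply]
    rw [hR, compress_leftSMul, mul_smul_comm,
      opTrace_smul _ (varNorm_compress_mul_ne_top hc hp' T.2 S.2), map_mul,
      iota_apply u ⟨a₀, a₁⟩]
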